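/- **Conventions.** A *Brouwer algebra* is a distributive lattice (join $+$, meet $\times$) with least element $0$ and greatest element $1$ in which $a\to b=\min\{c: a+c\ge b\}$ exists for all $a,b$; put $\neg a=a\to 1$. $\mathrm{Th}(\mathfrak L)$ is the set of propositional formulas that take the value $0$ under every valuation in $\mathfrak L$, where $\wedge,\vee,\to,\neg$ are interpreted by $+,\times,\to,\neg$. $\mathfrak L_1$ is *B-embeddable* in $\mathfrak L_2$ if there is an injective lattice homomorphism $\mathfrak L_1\to\mathfrak L_2$ that preserves $0$, $1$ and $\to$. For $a\in\mathfrak L$, the factor $\mathfrak L/a$ is the Brouwer algebra obtained from $\mathfrak L$ by factoring by the principal filter generated by $a$, that is, $b\le c$ in $\mathfrak L/a$ iff $b\times d\le c$ in $\mathfrak L$ for some $d\ge a$ (it is isomorphic to the initial segment $[0,a]$). A *mass problem* is a subset of $\omega^\omega$; $\mathcal A\le_M\mathcal B$ if some partial Turing functional $\Psi$ satisfies $\Psi(f)\in\mathcal A$ for every $f\in\mathcal B$. The degrees of the induced equivalence form the Medvedev lattice $\mathfrak M$, a Brouwer algebra whose operations are induced by $\mathcal A+\mathcal B=\{f\oplus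 g: f\in\mathcal A,\ g\in\mathcal B\}$, $\mathcal A\times\mathcal B=0^\frown\mathcal A\cup 1^\frown\mathcal B$ and $\mathcal A\to\mathcal B=\{z^\frown f: \forall g\in\mathcal A\ \Phi_z(g\oplus f)\in\mathcal B\}$. A *Muchnik degree* is an element of $\mathfrak M$ that contains a mass problem which is upwards closed under Turing reducibility. For $n\ge1$ let $\mathfrak B_n$ be the Brouwer algebra of all upwards closed subsets, ordered by $\supseteq$, of the poset of nonempty subsets of $\{0,\dots,n-1\}$, which is itself ordered by $\supseteq$. Let $\mathsf{LM}=\bigcap_{n\ge1}\mathrm{Th}(\mathfrak B_n)$ be the Medvedev logic of finite problems, and let $\mathsf{KP}$ be the logic obtained from the intuitionistic propositional calculus by adding (all substitution instances of) the formula $(\neg p\to q\vee r)\to(\neg p\to q)\vee(\neg p\to r)$. **Corollary.** There exists a Muchnik degree $\mathbf B_\omega$ such that for every $n\ge 1$ the algebra $\mathfrak B_n$ is B-embeddable in $\mathfrak M/\mathbf B_\omega$. Consequently, for every Muchnik degree $\mathbf B_\omega$ with this property, $$\mathsf{KP}\subseteq \mathrm{Th}(\mathfrak M/\mathbf B_\omega)\subseteq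 \mathsf{LM}.$$ -/

import Mathlib

/-! ### Partial Turing functionals -/

/-- The partial Turing functionals `Ψ`, which take an oracle `g : ℕ → ℕ` to the partial function
`Ψ g`: the smallest class that contains the basic functions and the evaluation of the oracle and is
closed under pairing, composition, primitive recursion and minimization, all of them uniformly in
the oracle (compare `Nat.RecursiveIn`, where the oracle is fixed). -/
inductive TuringFunctional : ((ℕ → ℕ) → ℕ →. ℕ) → Prop
  | zero : TuringFunctional fun _ _ => Part.some 0
  | succ : TuringFunctional fun _ n => Part.some (n + 1)
  | left : TuringFunctional fun _ n => Part.some n.unpair.1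
  | right : TuringFunctional fun _ n => Part.some n.unpair.2
  | oracle : TuringFunctional fun g n => Part.some (g n)
  | pair {F H : (ℕ → ℕ) → ℕ →. ℕ} (hF : TuringFunctional F) (hH : TuringFunctional H) :
      TuringFunctional fun g n => (F g n).bind fun a => (H g n).map fun b => Nat.pair a b
  | comp {F H : (ℕ → ℕ) → ℕ →. ℕ} (hF : TuringFunctional F) (hH : TuringFunctional H) :
      TuringFunctional fun g n => (H g n).bind fun m => F g m
  | prec {F H : (ℕ → ℕ) → ℕ →. ℕ} (hF : TuringFunctional F) (hH : TuringFunctional H) :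
      TuringFunctional fun g p => Nat.rec (motive := fun _ => Part ℕ) (F g p.unpair.1)
        (fun y IH => IH.bind fun i => H g (Nat.pair p.unpair.1 (Nat.pair y i))) p.unpair.2
  | rfind {F : (ℕ → ℕ) → ℕ →. ℕ} (hF : TuringFunctional F) :
      TuringFunctional fun g a =>
        Nat.rfind fun n => (F g (Nat.pair a n)).map fun m => decide (m = 0)

/-- The `e`-th partial Turing functional: to compute `turingPhi e g n`, run the `e`-th partial
recursive function on `n` and longer and longer finite initial segments of the oracle `g`, for more
and more steps, until one of these computations halts. By `turingFunctional_iff` this enumerates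
exactly the partial Turing functionals. -/
def turingPhi (e : ℕ) (g : ℕ → ℕ) : ℕ →. ℕ := fun n =>
  Nat.rfindOpt fun k => Nat.Partrec.Code.evaln k.unpair.1 (Denumerable.ofNat Nat.Partrec.Code e)
    (Nat.pair (Encodable.encode ((List.range k.unpair.2).map g)) n)

namespace TuringFunctional

variable {F G H : (ℕ → ℕ) → ℕ →. ℕ}

theorem of_eq (hF : TuringFunctional F) (h : ∀ g n, F g n = G g n) : TuringFunctional G :=
  (funext fun g => funext fun n => h g n : F = G) ▸ hF

theorem of_partrec {f : ℕ →. ℕ} (hf : Nat.Partrec f) : TuringFunctional fun _ => f := by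
  induction hf with
  | zero => exact zero
  | succ => exact succ
  | left => exact left
  | right => exact right
  | pair _ _ h1 h2 =>
    refine (h1.pair h2).of_eq fun g n => ?_
    simp [Seq.seq, Part.bind_map]
  | comp _ _ h1 h2 => exact h1.comp h2
  | prec _ _ h1 h2 => exact h1.prec h2
  | rfind _ h1 => exact h1.rfind

theorem of_computable {f : ℕ → ℕ} (hf : Computable f) :
    TuringFunctional fun _ n => Part.some (f n) :=
  of_partrec (Partrec.nat_iff.1 hf)

theorem comp_total (hF : TuringFunctional F) {h : (ℕ → ℕ) → ℕ → ℕ}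
    (hh : TuringFunctional fun g n => Part.some (h g n)) :
    TuringFunctional fun g n => F g (h g n) :=
  (hF.comp hh).of_eq fun _ _ => Part.bind_some _ _

theorem comp_computable (hF : TuringFunctional F) {f : ℕ → ℕ} (hf : Computable f) :
    TuringFunctional fun g n => F g (f n) :=
  hF.comp_total (of_computable hf)

theorem pair_total {h k : (ℕ → ℕ) → ℕ → ℕ}
    (hh : TuringFunctional fun g n => Part.some (h g n))
    (hk : TuringFunctional fun g n => Part.some (k g n)) :
    TuringFunctional fun g n => Part.some (Nat.pair (h g n) (k g n)) :=
  (hh.pair hk).of_eq fun g n => by simp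

/-- The finite initial segments of the oracle. -/
theorem initial_segment :
    TuringFunctional fun g n => Part.some (Encodable.encode ((List.range n).map g)) := by
  let c : ℕ → ℕ := fun q => Encodable.encode
    ((Denumerable.ofNat (List ℕ) q.unpair.1) ++ [q.unpair.2])
  have hc : Computable c := by
    refine Primrec.to_comp (Primrec.encode.comp (Primrec.list_concat.comp ?_ ?_))
    · exact (Primrec.ofNat _).comp (Primrec.fst.comp Primrec.unpair)
    · exact Primrec.snd.comp Primrec.unpair
  have hi : Computable fun q : ℕ => q.unpair.2.unpair.2 :=
    (Primrec.snd.comp (Primrec.unpair.comp (Primrec.snd.comp Primrec.unpair))).to_comp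
  have hy : Computable fun q : ℕ => q.unpair.2.unpair.1 :=
    (Primrec.fst.comp (Primrec.unpair.comp (Primrec.snd.comp Primrec.unpair))).to_comp
  have h1 := (of_computable hc).comp_total (pair_total (of_computable hi)
    (oracle.comp_computable hy))
  have hp : Computable fun n : ℕ => Nat.pair 0 n :=
    (Primrec₂.natPair.comp (Primrec.const 0) Primrec.id).to_comp
  refine ((zero.prec h1).comp_computable hp).of_eq fun g n => ?_
  simp only [Nat.unpair_pair]
  induction n with
  | zero => simp
  | succ n ih =>
    change Part.bind _ _ = _
    rw [ih]
    simp [c, List.range_succ]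

/-- The enumeration theorem: `turingPhi e g n` is computable uniformly in `e`, `g` and `n`. -/
theorem universal : TuringFunctional fun g p => turingPhi p.unpair.1 g p.unpair.2 := by
  let v : (ℕ → ℕ) → ℕ → ℕ → Option ℕ := fun g p k =>
    Nat.Partrec.Code.evaln k.unpair.1 (Denumerable.ofNat Nat.Partrec.Code p.unpair.1)
      (Nat.pair (Encodable.encode ((List.range k.unpair.2).map g)) p.unpair.2)
  let w : ℕ → ℕ := fun q => Encodable.encode (Nat.Partrec.Code.evaln q.unpair.1.unpair.2.unpair.1
    (Denumerable.ofNat Nat.Partrec.Code q.unpair.1.unpair.1.unpair.1)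
      (Nat.pair q.unpair.2 q.unpair.1.unpair.1.unpair.2))
  have l : Primrec fun q : ℕ => q.unpair.1 := Primrec.fst.comp Primrec.unpair
  have r : Primrec fun q : ℕ => q.unpair.2 := Primrec.snd.comp Primrec.unpair
  have hw : Computable w := by
    refine Primrec.to_comp (Primrec.encode.comp (Nat.Partrec.Code.primrec_evaln.comp
      (((l.comp (r.comp l)).pair ((Primrec.ofNat _).comp (l.comp (l.comp l)))).pair
      (Primrec₂.natPair.comp r (r.comp (l.comp l))))))
  have hv : TuringFunctional fun g q =>
      Part.some (Encodable.encode (v g q.unpair.1 q.unpair.2)) := by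
    refine ((of_computable hw).comp_total (pair_total (of_computable Computable.id)
      (initial_segment.comp_computable (r.comp r).to_comp))).of_eq fun g q => ?_
    simp [w, v]
  have hs : Computable fun m : ℕ => 1 - m :=
    (Primrec.nat_sub.comp (Primrec.const 1) Primrec.id).to_comp
  have h1 := ((of_computable hs).comp_total hv).rfind
  have hpair : TuringFunctional fun g p => (Nat.rfind fun k => Part.some (v g p k).isSome).map
      fun k => Nat.pair p k := by
    refine ((of_computable Computable.id).pair h1).of_eq fun g p => ?_
    simp only [id, Part.bind_some, Part.map_some, Nat.unpair_pair]
    congr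
    funext k
    cases v g p k <;> simp
  refine ((of_computable (Primrec.pred.to_comp)).comp (hv.comp hpair)).of_eq fun g p => ?_
  have e : turingPhi p.unpair.1 g p.unpair.2 = Nat.rfindOpt (v g p) := rfl
  rw [e]
  ext y
  simp only [Nat.rfindOpt, Part.mem_bind_iff, Part.mem_map_iff]
  constructor
  · rintro ⟨a, ⟨b, ⟨k, hk, rfl⟩, hb⟩, hy⟩
    have hk2 := (Nat.mem_rfind.1 hk).1
    simp only [Nat.unpair_pair, Part.mem_some_iff] at hb hy hk2
    refine ⟨k, hk, ?_⟩
    cases hvk : v g p k with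
    | none => simp [hvk] at hk2
    | some z => subst hb; simp [hvk] at hy; simp [hy]
  · rintro ⟨k, hk, hy⟩
    refine ⟨_, ⟨_, ⟨k, hk, rfl⟩, Part.mem_some _⟩, ?_⟩
    have hv : v g p k = some y := by simpa using hy
    simp [hv]

/-- A Turing functional is determined by a partial recursive function of finite oracle
information. -/
theorem exists_approx (hF : TuringFunctional F) : ∃ φ : List ℕ → ℕ →. ℕ, Partrec₂ φ ∧
    (∀ g n k y, y ∈ φ ((List.range k).map g) n → y ∈ F g n) ∧
    (∀ g n y, y ∈ F g n → ∀ᶠ k in Filter.atTop, y ∈ φ ((List.range k).map g) n) := by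
  induction hF with
  | zero => exact ⟨fun _ _ => Part.some 0, (Computable.const 0), by simp, by simp⟩
  | succ => exact ⟨fun _ n => Part.some (n + 1), (Computable.succ.comp Computable.snd),
      by simp, by simp⟩
  | left => exact ⟨fun _ n => Part.some n.unpair.1,
      (Computable.fst.comp (Computable.unpair.comp Computable.snd)), by simp, by simp⟩
  | right => exact ⟨fun _ n => Part.some n.unpair.2,
      (Computable.snd.comp (Computable.unpair.comp Computable.snd)), by simp, by simp⟩
  | oracle =>
    refine ⟨fun L n => (L[n]? : Option ℕ), ?_, ?_, ?_⟩
    · exact (Primrec.list_getElem?.to_comp).ofOption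
    · intro g n k y hy
      simp only [Part.mem_coe, Option.mem_def, List.getElem?_map, Option.map_eq_some_iff] at hy
      obtain ⟨a, ha, rfl⟩ := hy
      obtain ⟨h, rfl⟩ := List.getElem?_eq_some_iff.1 ha
      simp
    · intro g n y hy
      filter_upwards [Filter.eventually_gt_atTop n] with k hk
      simp only [Part.mem_some_iff] at hy
      simp [hk, hy]
  | pair _ _ h1 h2 =>
    obtain ⟨φ, cφ, sφ, tφ⟩ := h1
    obtain ⟨ψ, cψ, sψ, tψ⟩ := h2
    refine ⟨fun L n => (φ L n).bind fun a => (ψ L n).map fun b => Nat.pair a b, ?_, ?_, ?_⟩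
    · refine Partrec.bind cφ (Partrec.map (Partrec.comp cψ Computable.fst) ?_)
      exact (Primrec₂.natPair.to_comp).comp (Computable.snd.comp Computable.fst) Computable.snd
    · intro g n k y hy
      simp only [Part.mem_bind_iff, Part.mem_map_iff] at hy ⊢
      obtain ⟨a, ha, b, hb, rfl⟩ := hy
      exact ⟨a, sφ _ _ _ _ ha, b, sψ _ _ _ _ hb, rfl⟩
    · intro g n y hy
      simp only [Part.mem_bind_iff, Part.mem_map_iff] at hy ⊢
      obtain ⟨a, ha, b, hb, rfl⟩ := hy
      filter_upwards [tφ _ _ _ ha, tψ _ _ _ hb] with k h h'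
      exact ⟨a, h, b, h', rfl⟩
  | comp _ _ h1 h2 =>
    obtain ⟨φ, cφ, sφ, tφ⟩ := h1
    obtain ⟨ψ, cψ, sψ, tψ⟩ := h2
    refine ⟨fun L n => (ψ L n).bind fun m => φ L m, ?_, ?_, ?_⟩
    · refine Partrec.bind cψ ?_
      exact Partrec₂.comp cφ (Computable.fst.comp Computable.fst) Computable.snd
    · intro g n k y hy
      obtain ⟨a, ha, hb⟩ := Part.mem_bind_iff.1 hy
      exact Part.mem_bind_iff.2 ⟨a, sψ _ _ _ _ ha, sφ _ _ _ _ hb⟩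
    · intro g n y hy
      obtain ⟨a, ha, hb⟩ := Part.mem_bind_iff.1 hy
      filter_upwards [tψ _ _ _ ha, tφ _ _ _ hb] with k h h'
      exact Part.mem_bind_iff.2 ⟨a, h, h'⟩
  | prec _ _ h1 h2 =>
    obtain ⟨φ, cφ, sφ, tφ⟩ := h1
    obtain ⟨ψ, cψ, sψ, tψ⟩ := h2
    refine ⟨fun L p => Nat.rec (motive := fun _ => Part ℕ) (φ L p.unpair.1)
      (fun y IH => IH.bind fun i => ψ L (Nat.pair p.unpair.1 (Nat.pair y i))) p.unpair.2,
      ?_, ?_, ?_⟩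
    · have hl : Computable fun q : List ℕ × ℕ => q.2.unpair.1 :=
        Computable.fst.comp (Computable.unpair.comp Computable.snd)
      have hr : Computable fun q : List ℕ × ℕ => q.2.unpair.2 :=
        Computable.snd.comp (Computable.unpair.comp Computable.snd)
      have hb : Partrec fun q : List ℕ × ℕ => φ q.1 q.2.unpair.1 :=
        Partrec₂.comp cφ Computable.fst hl
      have hst : Partrec₂ fun (q : List ℕ × ℕ) (r : ℕ × ℕ) =>
          ψ q.1 (Nat.pair q.2.unpair.1 (Nat.pair r.1 r.2)) := by
        refine Partrec₂.comp cψ (Computable.fst.comp Computable.fst) ?_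
        exact (Primrec₂.natPair.to_comp).comp (hl.comp Computable.fst)
          ((Primrec₂.natPair.to_comp).comp (Computable.fst.comp Computable.snd)
            (Computable.snd.comp Computable.snd))
      exact Partrec.nat_rec hr hb hst
    · intro g p k
      dsimp only
      induction p.unpair.2 with
      | zero => exact fun y hy => sφ _ _ _ _ hy
      | succ n ih =>
        intro y hy
        simp only [Part.mem_bind_iff] at hy ⊢
        obtain ⟨a, ha, hb⟩ := hy
        exact ⟨a, ih _ ha, sψ _ _ _ _ hb⟩
    · intro g p
      dsimp only
      induction p.unpair.2 with
      | zero => exact fun y hy => tφ _ _ _ hy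
      | succ n ih =>
        intro y hy
        simp only [Part.mem_bind_iff] at hy ⊢
        obtain ⟨a, ha, hb⟩ := hy
        filter_upwards [ih _ ha, tψ _ _ _ hb] with k h h'
        exact ⟨a, h, h'⟩
  | rfind _ h1 =>
    obtain ⟨φ, cφ, sφ, tφ⟩ := h1
    refine ⟨fun L a => Nat.rfind fun n => (φ L (Nat.pair a n)).map fun m => decide (m = 0),
      ?_, ?_, ?_⟩
    · have hp : Partrec₂ fun (q : List ℕ × ℕ) (n : ℕ) =>
          (φ q.1 (Nat.pair q.2 n)).map fun m => decide (m = 0) := by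
        refine Partrec.map (Partrec₂.comp cφ (Computable.fst.comp Computable.fst)
          ((Primrec₂.natPair.to_comp).comp (Computable.snd.comp Computable.fst)
            Computable.snd)) ?_
        exact ((Primrec.eq.comp Primrec.id (Primrec.const 0)).decide.to_comp).comp Computable.snd
      exact Partrec.rfind hp
    · intro g n k y hy
      refine Nat.mem_rfind.2 ?_
      replace hy := Nat.mem_rfind.1 hy
      simp only [Part.mem_map_iff] at hy ⊢
      obtain ⟨⟨m, hm, hm'⟩, h⟩ := hy
      refine ⟨⟨m, sφ _ _ _ _ hm, hm'⟩, fun hlt => ?_⟩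
      obtain ⟨m, hm, hm'⟩ := h hlt
      exact ⟨m, sφ _ _ _ _ hm, hm'⟩
    · intro g n y hy
      replace hy := Nat.mem_rfind.1 hy
      simp only [Part.mem_map_iff] at hy
      obtain ⟨⟨m, hm, hm'⟩, h⟩ := hy
      have h2 : ∀ᶠ k in Filter.atTop, ∀ j ∈ Finset.range y,
          ∃ a ∈ φ ((List.range k).map g) (Nat.pair n j), decide (a = 0) = false := by
        rw [Filter.eventually_all_finset]
        intro j hj
        obtain ⟨a, ha, ha'⟩ := h (Finset.mem_range.1 hj)
        filter_upwards [tφ _ _ _ ha] with k hk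
        exact ⟨a, hk, ha'⟩
      filter_upwards [tφ _ _ _ hm, h2] with k hk hk'
      refine Nat.mem_rfind.2 ?_
      simp only [Part.mem_map_iff]
      exact ⟨⟨m, hk, hm'⟩, fun hlt => hk' _ (Finset.mem_range.2 hlt)⟩

end TuringFunctional

theorem turingFunctional_iff {F : (ℕ → ℕ) → ℕ →. ℕ} :
    TuringFunctional F ↔ ∃ e, F = turingPhi e := by
  constructor
  · intro hF
    obtain ⟨φ, cφ, sφ, tφ⟩ := hF.exists_approx
    have hn : Nat.Partrec fun q => φ (Denumerable.ofNat (List ℕ) q.unpair.1) q.unpair.2 := by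
      refine Partrec.nat_iff.1 (Partrec₂.comp cφ ?_ ?_)
      · exact ((Primrec.ofNat _).comp (Primrec.fst.comp Primrec.unpair)).to_comp
      · exact Computable.snd.comp Computable.unpair
    obtain ⟨c, hc⟩ := Nat.Partrec.Code.exists_code.1 hn
    refine ⟨Encodable.encode c, funext fun g => funext fun n => ?_⟩
    have hs : ∀ y, y ∈ turingPhi (Encodable.encode c) g n → y ∈ F g n := by
      intro y hy
      obtain ⟨k, hk⟩ := Nat.rfindOpt_spec hy
      have := Nat.Partrec.Code.evaln_sound hk
      rw [Denumerable.ofNat_encode, hc] at this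
      exact sφ _ _ k.unpair.2 _ (by simpa using this)
    ext y
    refine ⟨fun hy => ?_, hs y⟩
    have hd : (turingPhi (Encodable.encode c) g n).Dom := by
      obtain ⟨k, hk⟩ := (tφ _ _ _ hy).exists
      have h1 : y ∈ c.eval (Nat.pair (Encodable.encode ((List.range k).map g)) n) := by
        rw [hc]; simpa using hk
      obtain ⟨l, hl⟩ := Nat.Partrec.Code.evaln_complete.1 h1
      refine Nat.rfindOpt_dom.2 ⟨Nat.pair l k, y, ?_⟩
      simpa using hl
    obtain ⟨z, hz⟩ := Part.dom_iff_mem.1 hd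
    rwa [Part.mem_unique hy (hs z hz)]
  · rintro ⟨e, rfl⟩
    have hp : Computable fun n : ℕ => Nat.pair e n :=
      (Primrec₂.natPair.comp (Primrec.const e) Primrec.id).to_comp
    exact (TuringFunctional.universal.comp_computable hp).of_eq fun g n => by simp

namespace TuringFunctional

variable {F G H : (ℕ → ℕ) → ℕ →. ℕ}

theorem ite (hF : TuringFunctional F) (hG : TuringFunctional G) {c : (ℕ → ℕ) → ℕ → ℕ}
    (hc : TuringFunctional fun g n => Part.some (c g n)) :
    TuringFunctional fun g n => if c g n = 0 then F g n else G g n := by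
  obtain ⟨a, rfl⟩ := turingFunctional_iff.1 hF
  obtain ⟨b, rfl⟩ := turingFunctional_iff.1 hG
  have hd : Computable fun m : ℕ => if m = 0 then a else b :=
    (Primrec.ite (Primrec.eq.comp Primrec.id (Primrec.const 0)) (Primrec.const a)
      (Primrec.const b)).to_comp
  refine (universal.comp_total (pair_total ((of_computable hd).comp_total hc)
    (of_computable Computable.id))).of_eq fun g n => ?_
  by_cases h : c g n = 0 <;> simp [h]

/-- Composition of partial functionals. -/
theorem exists_comp (hF : TuringFunctional F) (hH : TuringFunctional H) :
    ∃ K, TuringFunctional K ∧ ∀ g h : ℕ → ℕ, H g = (h : ℕ →. ℕ) → K g = F h := by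
  induction hF with
  | zero => exact ⟨_, zero, fun _ _ _ => rfl⟩
  | succ => exact ⟨_, succ, fun _ _ _ => rfl⟩
  | left => exact ⟨_, left, fun _ _ _ => rfl⟩
  | right => exact ⟨_, right, fun _ _ _ => rfl⟩
  | oracle => exact ⟨_, hH, fun _ _ e => e⟩
  | pair _ _ h1 h2 =>
    obtain ⟨K, hK, eK⟩ := h1
    obtain ⟨M, hM, eM⟩ := h2
    exact ⟨_, hK.pair hM, fun g h e => by simp only [eK g h e, eM g h e]; rfl⟩
  | comp _ _ h1 h2 =>
    obtain ⟨K, hK, eK⟩ := h1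
    obtain ⟨M, hM, eM⟩ := h2
    exact ⟨_, hK.comp hM, fun g h e => by simp only [eK g h e, eM g h e]; rfl⟩
  | prec _ _ h1 h2 =>
    obtain ⟨K, hK, eK⟩ := h1
    obtain ⟨M, hM, eM⟩ := h2
    exact ⟨_, hK.prec hM, fun g h e => by simp only [eK g h e, eM g h e]; rfl⟩
  | rfind _ h1 =>
    obtain ⟨K, hK, eK⟩ := h1
    exact ⟨_, hK.rfind, fun g h e => by simp only [eK g h e]; rfl⟩

end TuringFunctional

/-! ### The Medvedev lattice -/

/-- `f ⊕ g`, with `(f ⊕ g)(2x) = f x` and `(f ⊕ g)(2x+1) = g x`. -/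
def turingJoin (f g : ℕ → ℕ) : ℕ → ℕ := fun n => if n % 2 = 0 then f (n / 2) else g (n / 2)

/-- The concatenation of the one-element string `a` with the infinite string `f`. -/
def stringCons (a : ℕ) (f : ℕ → ℕ) : ℕ → ℕ := fun n => if n = 0 then a else f (n - 1)

/-- A mass problem: a set of functions from `ℕ` to `ℕ`, its solutions. -/
@[ext]
structure MassProblem where
  sol : Set (ℕ → ℕ)

namespace MassProblem

/-- Medvedev reducibility: one partial Turing functional takes every solution of `B` to a solution
of `A`. -/
def Reducible (A B : MassProblem) : Prop :=
  ∃ F, TuringFunctional F ∧ ∀ g ∈ B.sol, ∃ f ∈ A.sol, F g = (f : ℕ →. ℕ)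

instance : Preorder MassProblem where
  le := Reducible
  le_refl A := ⟨_, TuringFunctional.oracle, fun g hg => ⟨g, hg, rfl⟩⟩
  le_trans A B C := by
    rintro ⟨F, hF, hAB⟩ ⟨H, hH, hBC⟩
    obtain ⟨K, hK, e⟩ := hF.exists_comp hH
    refine ⟨K, hK, fun g hg => ?_⟩
    obtain ⟨f, hf, e1⟩ := hBC g hg
    rw [e g f e1]
    exact hAB f hf

/-- The join `A + B`. -/
def join (A B : MassProblem) : MassProblem :=
  ⟨{h | ∃ f ∈ A.sol, ∃ g ∈ B.sol, h = turingJoin f g}⟩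

/-- The meet `A × B`. -/
def meet (A B : MassProblem) : MassProblem :=
  ⟨stringCons 0 '' A.sol ∪ stringCons 1 '' B.sol⟩

/-- The mass problem `A → B`. -/
def imp (A B : MassProblem) : MassProblem :=
  ⟨{h | ∃ z f, h = stringCons z f ∧
    ∀ g ∈ A.sol, ∃ k ∈ B.sol, turingPhi z (turingJoin g f) = (k : ℕ →. ℕ)}⟩

theorem le_join_left (A B : MassProblem) : A ≤ A.join B := by
  have hc : Computable fun n : ℕ => 2 * n :=
    (Primrec.nat_mul.comp (Primrec.const 2) Primrec.id).to_comp
  refine ⟨_, TuringFunctional.oracle.comp_computable hc, ?_⟩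
  rintro _ ⟨f, hf, g, hg, rfl⟩
  refine ⟨f, hf, funext fun n => ?_⟩
  simp [turingJoin]

theorem odd_part : TuringFunctional fun g n => Part.some (g (2 * n + 1)) := by
  have hc : Computable fun n : ℕ => 2 * n + 1 :=
    (Primrec.succ.comp (Primrec.nat_mul.comp (Primrec.const 2) Primrec.id)).to_comp
  exact TuringFunctional.oracle.comp_computable hc

theorem turingJoin_odd (f g : ℕ → ℕ) (n : ℕ) : turingJoin f g (2 * n + 1) = g n := by
  have h1 : (2 * n + 1) % 2 ≠ 0 := by omega
  have h2 : (2 * n + 1) / 2 = n := by omega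
  simp [turingJoin, h2]

theorem le_join_right (A B : MassProblem) : B ≤ A.join B := by
  refine ⟨_, odd_part, ?_⟩
  rintro _ ⟨f, hf, g, hg, rfl⟩
  exact ⟨g, hg, funext fun n => by simp [turingJoin_odd]⟩

theorem join_functional {F G : (ℕ → ℕ) → ℕ →. ℕ} (hF : TuringFunctional F)
    (hG : TuringFunctional G) :
    TuringFunctional fun g n => if n % 2 = 0 then F g (n / 2) else G g (n / 2) := by
  have hm : Computable fun n : ℕ => n % 2 :=
    (Primrec.nat_mod.comp Primrec.id (Primrec.const 2)).to_comp
  have hd : Computable fun n : ℕ => n / 2 :=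
    (Primrec.nat_div.comp Primrec.id (Primrec.const 2)).to_comp
  exact TuringFunctional.ite (hF.comp_computable hd) (hG.comp_computable hd)
    (TuringFunctional.of_computable hm)

theorem join_le {A B C : MassProblem} (hA : A ≤ C) (hB : B ≤ C) : A.join B ≤ C := by
  obtain ⟨F, hF, hAC⟩ := hA
  obtain ⟨G, hG, hBC⟩ := hB
  refine ⟨_, join_functional hF hG, fun g hg => ?_⟩
  obtain ⟨a, ha, ea⟩ := hAC g hg
  obtain ⟨b, hb, eb⟩ := hBC g hg
  refine ⟨_, ⟨a, ha, b, hb, rfl⟩, funext fun n => ?_⟩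
  by_cases h : n % 2 = 0 <;> simp [ea, eb, turingJoin, h]

theorem cons_functional (a : ℕ) : TuringFunctional fun g n => Part.some (stringCons a g n) := by
  refine (TuringFunctional.ite
    (TuringFunctional.of_computable (Computable.const a))
    (TuringFunctional.oracle.comp_computable Primrec.pred.to_comp)
    (TuringFunctional.of_computable Computable.id)).of_eq fun g n => ?_
  by_cases h : n = 0 <;> simp [h, stringCons]

theorem meet_le_left (A B : MassProblem) : A.meet B ≤ A :=
  ⟨_, cons_functional 0, fun g hg => ⟨_, Or.inl ⟨g, hg, rfl⟩, rfl⟩⟩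

theorem meet_le_right (A B : MassProblem) : A.meet B ≤ B :=
  ⟨_, cons_functional 1, fun g hg => ⟨_, Or.inr ⟨g, hg, rfl⟩, rfl⟩⟩

theorem tail_cons (a : ℕ) (f : ℕ → ℕ) (n : ℕ) : stringCons a f (n + 1) = f n := by
  simp [stringCons]

theorem le_meet {A B C : MassProblem} (hA : C ≤ A) (hB : C ≤ B) : C ≤ A.meet B := by
  obtain ⟨F, hF, hCA⟩ := hA
  obtain ⟨G, hG, hCB⟩ := hB
  have ht : TuringFunctional fun g n => Part.some (g (n + 1)) :=
    TuringFunctional.oracle.comp_computable Computable.succ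
  obtain ⟨F', hF', eF⟩ := hF.exists_comp ht
  obtain ⟨G', hG', eG⟩ := hG.exists_comp ht
  refine ⟨_, TuringFunctional.ite hF' hG'
    (TuringFunctional.oracle.comp_computable (Computable.const 0)), ?_⟩
  have tc : ∀ a f, (fun n => Part.some (stringCons a f (n + 1)) : ℕ →. ℕ) = (f : ℕ →. ℕ) :=
    fun a f => funext fun n => by rw [tail_cons]; rfl
  rintro _ (⟨f, hf, rfl⟩ | ⟨f, hf, rfl⟩)
  · obtain ⟨c, hc, e⟩ := hCA f hf
    refine ⟨c, hc, ?_⟩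
    rw [← e, ← eF _ _ (tc 0 f)]
    rfl
  · obtain ⟨c, hc, e⟩ := hCB f hf
    refine ⟨c, hc, ?_⟩
    rw [← e, ← eG _ _ (tc 1 f)]
    rfl

/-- `A → B` is the least `C` with `B ≤ A + C`, up to Medvedev equivalence. -/
theorem imp_le_iff (A B C : MassProblem) : A.imp B ≤ C ↔ B ≤ A.join C := by
  constructor
  · rintro ⟨F, hF, h⟩
    obtain ⟨K, hK, eK⟩ := hF.exists_comp odd_part
    have hev : Computable fun n : ℕ => 2 * n :=
      (Primrec.nat_mul.comp (Primrec.const 2) Primrec.id).to_comp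
    have hJ := join_functional (TuringFunctional.oracle.comp_computable hev)
      (hK.comp_computable Computable.succ)
    obtain ⟨U, hU, eU⟩ := TuringFunctional.universal.exists_comp hJ
    have hR := hU.comp ((hK.comp_computable (Computable.const 0)).pair
      (TuringFunctional.of_computable Computable.id))
    refine ⟨_, hR, ?_⟩
    rintro _ ⟨g, hg, c, hc, rfl⟩
    obtain ⟨_, ⟨z, f, rfl, hz⟩, e⟩ := h c hc
    obtain ⟨k, hk, e2⟩ := hz g hg
    refine ⟨k, hk, ?_⟩
    have e3 : K (turingJoin g c) = (stringCons z f : ℕ →. ℕ) := by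
      rw [eK _ c, e]
      exact funext fun n => by rw [turingJoin_odd]; rfl
    have e4 := eU (turingJoin g c) (turingJoin g f) (by
      funext n
      by_cases hn : n % 2 = 0
      · simp [hn, turingJoin]
      · simp [hn, turingJoin, e3, stringCons])
    funext n
    simp only [e3, e4]
    simp [stringCons, e2]
  · rintro ⟨F, hF, h⟩
    obtain ⟨e, rfl⟩ := turingFunctional_iff.1 hF
    refine ⟨_, cons_functional e, fun c hc => ⟨_, ⟨e, c, rfl, fun g hg => ?_⟩, rfl⟩⟩
    exact h _ ⟨g, hg, c, hc, rfl⟩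

theorem univ_le (A : MassProblem) : (⟨Set.univ⟩ : MassProblem) ≤ A :=
  ⟨_, TuringFunctional.oracle, fun g _ => ⟨g, trivial, rfl⟩⟩

theorem le_empty (A : MassProblem) : A ≤ (⟨∅⟩ : MassProblem) :=
  ⟨_, TuringFunctional.oracle, fun _ hg => hg.elim⟩

end MassProblem

/-- The Medvedev degrees: mass problems up to Medvedev equivalence. -/
def MedvedevDegree : Type := Antisymmetrization MassProblem (· ≤ ·)

namespace MedvedevDegree

instance : PartialOrder MedvedevDegree :=
  inferInstanceAs (PartialOrder (Antisymmetrization MassProblem (· ≤ ·)))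

/-- The Medvedev degree of a mass problem. -/
def deg (A : MassProblem) : MedvedevDegree := toAntisymmetrization (· ≤ ·) A

theorem deg_le_deg {A B : MassProblem} : deg A ≤ deg B ↔ A ≤ B := Iff.rfl

theorem ind {p : MedvedevDegree → Prop} (h : ∀ A, p (deg A)) (a : MedvedevDegree) : p a :=
  Quotient.ind h a

/-- The operation `→` on Medvedev degrees. -/
def imp : MedvedevDegree → MedvedevDegree → MedvedevDegree :=
  Quotient.map₂ MassProblem.imp fun A A' k B B' h =>
    ⟨(MassProblem.imp_le_iff _ _ _).2 (h.1.trans (((MassProblem.imp_le_iff A' B' _).1 le_rfl).trans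
      (MassProblem.join_le (k.2.trans (MassProblem.le_join_left _ _))
        (MassProblem.le_join_right _ _)))),
     (MassProblem.imp_le_iff _ _ _).2 (h.2.trans (((MassProblem.imp_le_iff A B _).1 le_rfl).trans
      (MassProblem.join_le (k.1.trans (MassProblem.le_join_left _ _))
        (MassProblem.le_join_right _ _))))⟩

/-- The Medvedev degrees as a Brouwer algebra. Mathlib writes `b \ a` for `a → b`. -/
instance : CoheytingAlgebra MedvedevDegree where
  sup := Quotient.map₂ MassProblem.join fun _ _ h _ _ k =>
    ⟨MassProblem.join_le (h.1.trans (MassProblem.le_join_left _ _))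
      (k.1.trans (MassProblem.le_join_right _ _)),
     MassProblem.join_le (h.2.trans (MassProblem.le_join_left _ _))
      (k.2.trans (MassProblem.le_join_right _ _))⟩
  le_sup_left := ind fun A => ind fun B => MassProblem.le_join_left A B
  le_sup_right := ind fun A => ind fun B => MassProblem.le_join_right A B
  sup_le := ind fun _ => ind fun _ => ind fun _ h k => MassProblem.join_le h k
  inf := Quotient.map₂ MassProblem.meet fun _ _ h _ _ k =>
    ⟨MassProblem.le_meet ((MassProblem.meet_le_left _ _).trans h.1)
      ((MassProblem.meet_le_right _ _).trans k.1),
     MassProblem.le_meet ((MassProblem.meet_le_left _ _).trans h.2)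
      ((MassProblem.meet_le_right _ _).trans k.2)⟩
  inf_le_left := ind fun A => ind fun B => MassProblem.meet_le_left A B
  inf_le_right := ind fun A => ind fun B => MassProblem.meet_le_right A B
  le_inf := ind fun _ => ind fun _ => ind fun _ h k => MassProblem.le_meet h k
  bot := deg ⟨Set.univ⟩
  bot_le := ind MassProblem.univ_le
  top := deg ⟨∅⟩
  le_top := ind MassProblem.le_empty
  sdiff := fun b a => a.imp b
  sdiff_le_iff := ind fun B => ind fun A => ind fun C => MassProblem.imp_le_iff A B C
  hnot := fun a => a.imp (deg ⟨∅⟩)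
  top_sdiff := ind fun _ => rfl

/-- A Muchnik degree: a Medvedev degree that contains a mass problem which is upwards closed under
Turing reducibility. -/
def IsMuchnik (a : MedvedevDegree) : Prop :=
  ∃ A : MassProblem, deg A = a ∧
    ∀ f ∈ A.sol, ∀ g : ℕ → ℕ, TuringReducible (f : ℕ →. ℕ) (g : ℕ →. ℕ) → g ∈ A.sol

end MedvedevDegree

/-! ### Factors and embeddings of Brouwer algebras -/

section Factor

variable {L : Type*} [CoheytingAlgebra L]

/-- The order that the principal filter generated by `a` induces on `L`. -/
def FactorLE (a b c : L) : Prop := ∃ d, a ≤ d ∧ b ⊓ d ≤ c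

theorem factorLE_iff {a b c : L} : FactorLE a b c ↔ b ⊓ a ≤ c :=
  ⟨fun ⟨_, hd, h⟩ => (inf_le_inf_left b hd).trans h, fun h => ⟨a, le_rfl, h⟩⟩

theorem FactorLE.trans {a b c d : L} (h : FactorLE a b c) (k : FactorLE a c d) :
    FactorLE a b d := by
  rw [factorLE_iff] at *
  exact (le_inf h inf_le_right).trans k

/-- Two elements are identified if each is below the other modulo the filter. -/
def factorSetoid (a : L) : Setoid L where
  r b c := FactorLE a b c ∧ FactorLE a c b
  iseqv :=
    { refl := fun _ => ⟨⟨a, le_rfl, inf_le_left⟩, ⟨a, le_rfl, inf_le_left⟩⟩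
      symm := fun h => ⟨h.2, h.1⟩
      trans := fun h k => ⟨h.1.trans k.1, k.2.trans h.2⟩ }

/-- The factor `L / a` of `L` by the principal filter generated by `a`. -/
def Factor (a : L) : Type _ := Quotient (factorSetoid a)

namespace Factor

variable {a : L}

/-- The class of `b` in `L / a`. -/
def mk (a : L) (b : L) : Factor a := Quotient.mk (factorSetoid a) b

theorem ind {p : Factor a → Prop} (h : ∀ b, p (mk a b)) (x : Factor a) : p x :=
  Quotient.ind h x

instance : LE (Factor a) where
  le := Quotient.lift₂ (FactorLE a) fun _ _ _ _ h k =>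
    propext ⟨fun l => (h.2.trans l).trans k.1, fun l => (h.1.trans l).trans k.2⟩

theorem mk_le_mk {b c : L} : mk a b ≤ mk a c ↔ b ⊓ a ≤ c := factorLE_iff

theorem sup_aux {b c d : L} : (b ⊔ c) ⊓ a ≤ d ↔ b ⊓ a ≤ d ∧ c ⊓ a ≤ d := by
  rw [inf_sup_right, sup_le_iff]

theorem sdiff_aux {b c d : L} : (b ⊓ a) \ c ⊓ a ≤ d ↔ b ⊓ a ≤ c ⊔ d := by
  rw [inf_eq_left.2 (sdiff_le.trans inf_le_right), sdiff_le_iff]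

instance : PartialOrder (Factor a) where
  le_refl := ind fun _ => mk_le_mk.2 inf_le_left
  le_trans := ind fun _ => ind fun _ => ind fun _ h k => FactorLE.trans h k
  le_antisymm := ind fun _ => ind fun _ h k => Quotient.sound ⟨h, k⟩

/-- The operation `→` on the factor: `b → c` is the class of the element `b → c'` of `L`, where
`c' = c ⊓ a` represents the class of `c` in the initial segment below `a`. -/
def imp : Factor a → Factor a → Factor a :=
  Quotient.map₂ (fun b c => (c ⊓ a) \ b) (by
    intro b b' k c c' h
    change FactorLE _ _ _ ∧ FactorLE _ _ _ at h k ⊢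
    simp only [factorLE_iff, sdiff_aux] at *
    have key : ∀ {c c' b b' : L}, c ⊓ a ≤ c' → b' ⊓ a ≤ b → c ⊓ a ≤ b ⊔ (c' ⊓ a) \ b' := by
      intro c c' b b' h k
      have h1 : c ⊓ a ≤ b' ⊔ (c' ⊓ a) \ b' :=
        (le_inf h inf_le_right).trans (sdiff_le_iff.1 le_rfl)
      have h2 := le_inf h1 (inf_le_right : c ⊓ a ≤ a)
      rw [inf_sup_right] at h2
      exact h2.trans (sup_le_sup k inf_le_left)
    exact ⟨key h.1 k.2, key h.2 k.1⟩)

/-- The factor as a Brouwer algebra. -/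
instance : CoheytingAlgebra (Factor a) where
  sup := Quotient.map₂ (· ⊔ ·) (by
    intro b b' h c c' k
    change FactorLE _ _ _ ∧ FactorLE _ _ _ at h k ⊢
    simp only [factorLE_iff, sup_aux] at *
    exact ⟨⟨h.1.trans le_sup_left, k.1.trans le_sup_right⟩,
      ⟨h.2.trans le_sup_left, k.2.trans le_sup_right⟩⟩)
  le_sup_left := ind fun _ => ind fun _ => mk_le_mk.2 (inf_le_left.trans le_sup_left)
  le_sup_right := ind fun _ => ind fun _ => mk_le_mk.2 (inf_le_left.trans le_sup_right)
  sup_le := ind fun _ => ind fun _ => ind fun _ h k =>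
    mk_le_mk.2 (sup_aux.2 ⟨mk_le_mk.1 h, mk_le_mk.1 k⟩)
  inf := Quotient.map₂ (· ⊓ ·) (by
    intro b b' h c c' k
    change FactorLE _ _ _ ∧ FactorLE _ _ _ at h k ⊢
    simp only [factorLE_iff] at *
    exact ⟨le_inf ((inf_le_inf_right a inf_le_left).trans h.1)
        ((inf_le_inf_right a inf_le_right).trans k.1),
      le_inf ((inf_le_inf_right a inf_le_left).trans h.2)
        ((inf_le_inf_right a inf_le_right).trans k.2)⟩)
  inf_le_left := ind fun _ => ind fun _ => mk_le_mk.2 (inf_le_left.trans inf_le_left)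
  inf_le_right := ind fun _ => ind fun _ => mk_le_mk.2 (inf_le_left.trans inf_le_right)
  le_inf := ind fun _ => ind fun _ => ind fun _ h k =>
    mk_le_mk.2 (le_inf (mk_le_mk.1 h) (mk_le_mk.1 k))
  bot := mk a ⊥
  bot_le := ind fun _ => mk_le_mk.2 (inf_le_left.trans bot_le)
  top := mk a ⊤
  le_top := ind fun _ => mk_le_mk.2 le_top
  sdiff := fun y x => imp x y
  sdiff_le_iff := ind fun _ => ind fun _ => ind fun _ =>
    mk_le_mk.trans (sdiff_aux.trans mk_le_mk.symm)
  hnot := fun x => imp x (mk a ⊤)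
  top_sdiff := ind fun _ => rfl

end Factor

end Factor

/-- `L₁` is B-embeddable in `L₂`: there is an injective homomorphism of Brouwer algebras. (A
`CoheytingHom` preserves joins, meets, the greatest element and the implication, and hence also the
least element.) -/
def BEmbeddable (L₁ L₂ : Type*) [CoheytingAlgebra L₁] [CoheytingAlgebra L₂] : Prop :=
  ∃ f : CoheytingHom L₁ L₂, Function.Injective f

/-- The Brouwer algebra of the open (that is, upwards closed) subsets, ordered by `⊇`, of the poset
of nonempty subsets of `{0, …, n-1}`, itself ordered by `⊇`. (Mathlib orders `UpperSet` by `⊇`.) -/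
abbrev MedvedevAlgebra (n : ℕ) : Type := UpperSet ({s : Finset (Fin n) // s.Nonempty}ᵒᵈ)

/-! ### Propositional logics -/

/-- Propositional formulas. -/
inductive PropForm : Type
  | var : ℕ → PropForm
  | and : PropForm → PropForm → PropForm
  | or : PropForm → PropForm → PropForm
  | imp : PropForm → PropForm → PropForm
  | neg : PropForm → PropForm

namespace PropForm

/-- Simultaneous substitution of formulas for the variables. -/
def subst (σ : ℕ → PropForm) : PropForm → PropForm
  | var i => σ i
  | and φ ψ => and (subst σ φ) (subst σ ψ)
  | or φ ψ => or (subst σ φ) (subst σ ψ)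
  | imp φ ψ => imp (subst σ φ) (subst σ ψ)
  | neg φ => neg (subst σ φ)

/-- The value of a formula in a Brouwer algebra: conjunction is the join, disjunction is the meet,
`a → b` is the least `c` with `b ≤ a ⊔ c`, which is `b \ a`, and `¬ a` is `a → 1`. -/
def eval {L : Type*} [CoheytingAlgebra L] (v : ℕ → L) : PropForm → L
  | var i => v i
  | and φ ψ => eval v φ ⊔ eval v ψ
  | or φ ψ => eval v φ ⊓ eval v ψ
  | imp φ ψ => eval v ψ \ eval v φ
  | neg φ => ⊤ \ eval v φ

/-- Derivability in the logic `IPC + Γ`: a Hilbert calculus for intuitionistic propositional logic,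
together with all substitution instances of the formulas in `Γ`. -/
inductive Derivable (Γ : Set PropForm) : PropForm → Prop
  | extra {φ} (σ : ℕ → PropForm) : φ ∈ Γ → Derivable Γ (subst σ φ)
  | mp {φ ψ} : Derivable Γ (imp φ ψ) → Derivable Γ φ → Derivable Γ ψ
  | k (φ ψ) : Derivable Γ (imp φ (imp ψ φ))
  | s (φ ψ χ) : Derivable Γ (imp (imp φ (imp ψ χ)) (imp (imp φ ψ) (imp φ χ)))
  | and_left (φ ψ) : Derivable Γ (imp (and φ ψ) φ)
  | and_right (φ ψ) : Derivable Γ (imp (and φ ψ) ψ)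
  | and_intro (φ ψ) : Derivable Γ (imp φ (imp ψ (and φ ψ)))
  | or_left (φ ψ) : Derivable Γ (imp φ (or φ ψ))
  | or_right (φ ψ) : Derivable Γ (imp ψ (or φ ψ))
  | or_elim (φ ψ χ) : Derivable Γ (imp (imp φ χ) (imp (imp ψ χ) (imp (or φ ψ) χ)))
  | neg_intro (φ ψ) : Derivable Γ (imp (imp φ ψ) (imp (imp φ (neg ψ)) (neg φ)))
  | neg_elim (φ ψ) : Derivable Γ (imp (neg φ) (imp φ ψ))

/-- The Kreisel–Putnam formula `(¬p → q ∨ r) → (¬p → q) ∨ (¬p → r)`. -/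
def kreiselPutnam : PropForm :=
  imp (imp (neg (var 0)) (or (var 1) (var 2)))
    (or (imp (neg (var 0)) (var 1)) (imp (neg (var 0)) (var 2)))

end PropForm

/-- The theory `Th(L)` of a Brouwer algebra: the formulas that take the value `0` (truth) under
every valuation. -/
def BrouwerTheory (L : Type*) [CoheytingAlgebra L] : Set PropForm :=
  {φ | ∀ v : ℕ → L, φ.eval v = ⊥}

/-- The Kreisel–Putnam logic. -/
def LogicKP : Set PropForm := {φ | PropForm.Derivable {PropForm.kreiselPutnam} φ}

/-- The Medvedev logic of finite problems. -/
def LogicLM : Set PropForm := {φ | ∀ n : ℕ, 1 ≤ n → φ ∈ BrouwerTheory (MedvedevAlgebra n)}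

/-! A Baire category argument gives pairwise Turing incomparable functions `h i`. For a set `S` of
numbers let `A_S` be the degree of `avoidCones h S`; it is a Muchnik degree, and the witness is `B =
A_ω`. Incomparability gives `A_S + A_T = A_(S ∪ T)` and `A_S → A_T = A_(T \ S)`, so joins and
implications of these degrees are computed as in a power set.

Meets are governed by two facts about a Muchnik degree `d`. First, `(d → x) × (d → y) ≤ d → (x × y)`
(`IsMuchnik.inf_sdiff_le`): for given `f` one searches for a finite prefix of the oracle that
settles which side of the meet is solved; since a nonempty upwards closed problem stays closed under
prepending this prefix, one choice serves all its solutions. Second, `d` is meet-prime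
(`IsMuchnik.le_or_le_of_inf_le`), which follows from the first fact because `0` is meet-prime.

An element of `MedvedevAlgebra n` is a complex of subsets of `{0, …, n-1}`. With `a s = A_(P s)`,
where `P s` consists of the numbers whose residue modulo `n` is not in `s`, the embedding sends a
complex to the meet of `a s` over its simplices. Distributivity yields joins, the first fact yields
implications, and primeness yields injectivity.

For the logics: in `Factor B` with `B` Muchnik every negation is the class of `B \ p`, again a
Muchnik degree, so the first fact is the validity of the Kreisel–Putnam formula. Formulas valid in
an algebra are valid in every algebra that embeds in it, which gives the inclusion in `LogicLM`. -/

/-! ### Turing functionals and Turing reducibility -/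

namespace TuringFunctional

variable {F : (ℕ → ℕ) → ℕ →. ℕ}

theorem recursiveIn (hF : TuringFunctional F) (g : ℕ → ℕ) :
    Nat.RecursiveIn {(g : ℕ →. ℕ)} (F g) := by
  induction hF with
  | zero => exact .zero
  | succ => exact .succ
  | left => exact .left
  | right => exact .right
  | oracle => exact .oracle _ rfl
  | pair _ _ h1 h2 =>
    refine (h1.pair h2).of_eq fun n => ?_
    simp [Seq.seq, Part.bind_map]
  | comp _ _ h1 h2 => exact h1.comp h2
  | prec _ _ h1 h2 => exact h1.prec h2
  | rfind _ h1 => exact h1.rfind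

theorem turingReducible (hF : TuringFunctional F) {f g : ℕ → ℕ} (h : F g = (f : ℕ →. ℕ)) :
    TuringReducible (f : ℕ →. ℕ) (g : ℕ →. ℕ) :=
  RecursiveIn.iff_nat.2 (h ▸ hF.recursiveIn g)

/-- A halting computation uses only a finite initial segment of the oracle. -/
theorem exists_use (hF : TuringFunctional F) {g : ℕ → ℕ} {n y : ℕ} (hy : y ∈ F g n) :
    ∃ k, ∀ g' : ℕ → ℕ, (∀ i < k, g' i = g i) → y ∈ F g' n := by
  obtain ⟨φ, -, sφ, tφ⟩ := hF.exists_approx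
  obtain ⟨k, hk⟩ := (tφ _ _ _ hy).exists
  refine ⟨k, fun g' h => sφ g' n k y ?_⟩
  rwa [List.map_congr_left fun i hi => h i (List.mem_range.1 hi)]

end TuringFunctional

/-- Every clause of relative recursion is already uniform in the oracle. With `turingReducible` this
lets reductions between single functions and functionals be exchanged freely. -/
theorem exists_turingFunctional {f : ℕ →. ℕ} {g : ℕ → ℕ}
    (h : TuringReducible f (g : ℕ →. ℕ)) : ∃ F, TuringFunctional F ∧ F g = f := by
  have h' := RecursiveIn.iff_nat.1 h
  clear h
  induction h' with
  | zero => exact ⟨_, .zero, rfl⟩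
  | succ => exact ⟨_, .succ, rfl⟩
  | left => exact ⟨_, .left, rfl⟩
  | right => exact ⟨_, .right, rfl⟩
  | oracle k hk => exact ⟨_, .oracle, (Set.mem_singleton_iff.1 hk).symm⟩
  | pair _ _ h1 h2 =>
    obtain ⟨F, hF, rfl⟩ := h1
    obtain ⟨H, hH, rfl⟩ := h2
    refine ⟨_, hF.pair hH, funext fun n => ?_⟩
    simp [Seq.seq, Part.bind_map]
  | comp _ _ h1 h2 =>
    obtain ⟨F, hF, rfl⟩ := h1
    obtain ⟨H, hH, rfl⟩ := h2
    exact ⟨_, hF.comp hH, rfl⟩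
  | prec _ _ h1 h2 =>
    obtain ⟨F, hF, rfl⟩ := h1
    obtain ⟨H, hH, rfl⟩ := h2
    exact ⟨_, hF.prec hH, rfl⟩
  | rfind _ h1 =>
    obtain ⟨F, hF, rfl⟩ := h1
    exact ⟨_, hF.rfind, rfl⟩

theorem turingJoin_even (f g : ℕ → ℕ) (n : ℕ) : turingJoin f g (2 * n) = f n := by
  simp [turingJoin]

theorem turingReducible_turingJoin_left (f g : ℕ → ℕ) :
    TuringReducible (f : ℕ →. ℕ) (turingJoin f g : ℕ →. ℕ) := by
  have hc : Computable fun n : ℕ => 2 * n :=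
    (Primrec.nat_mul.comp (Primrec.const 2) Primrec.id).to_comp
  exact (TuringFunctional.oracle.comp_computable hc).turingReducible
    (funext fun n => by simp [turingJoin_even])

theorem turingReducible_turingJoin_right (f g : ℕ → ℕ) :
    TuringReducible (g : ℕ →. ℕ) (turingJoin f g : ℕ →. ℕ) :=
  MassProblem.odd_part.turingReducible (funext fun n => by simp [MassProblem.turingJoin_odd])

theorem turingJoin_turingReducible {f g h : ℕ → ℕ} (hf : TuringReducible (f : ℕ →. ℕ) (h : ℕ →. ℕ))
    (hg : TuringReducible (g : ℕ →. ℕ) (h : ℕ →. ℕ)) :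
    TuringReducible (turingJoin f g : ℕ →. ℕ) (h : ℕ →. ℕ) := by
  obtain ⟨F, hF, eF⟩ := exists_turingFunctional hf
  obtain ⟨G, hG, eG⟩ := exists_turingFunctional hg
  refine (MassProblem.join_functional hF hG).turingReducible (funext fun n => ?_)
  by_cases hn : n % 2 = 0 <;> simp [eF, eG, turingJoin, hn]

/-! ### An infinite antichain of Turing degrees -/

theorem isOpen_setOf_exists_mem_ne {F : (ℕ → ℕ) → ℕ →. ℕ} (hF : TuringFunctional F) (i j : ℕ) :
    IsOpen {x : ℕ × ℕ → ℕ | ∃ n, ∃ y ∈ F (fun m => x (j, m)) n, y ≠ x (i, n)} := by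
  refine isOpen_pi_iff.2 ?_
  rintro x ⟨n, y, hy, hne⟩
  obtain ⟨k, hk⟩ := hF.exists_use hy
  refine ⟨insert (i, n) ((Finset.range k).image fun m => (j, m)), fun p => {x p},
    fun p _ => ⟨isOpen_discrete _, rfl⟩, fun x' hx' => ⟨n, y, hk _ fun m hm => ?_, ?_⟩⟩
  · exact hx' (j, m) (by simpa using Or.inr hm)
  · rwa [show x' (i, n) = x (i, n) from hx' (i, n) (by simp)]

/-- Given a functional, generic columns `i ≠ j` of a function on `ℕ × ℕ` satisfy: either the
functional is partial on the oracle `j`, or its value differs from the column `i`. -/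
theorem dense_not_computes (F : (ℕ → ℕ) → ℕ →. ℕ) {i j : ℕ} (hij : i ≠ j) :
    Dense ({x : ℕ × ℕ → ℕ | ∃ n, ∃ y ∈ F (fun m => x (j, m)) n, y ≠ x (i, n)} ∪
      interior {x : ℕ × ℕ → ℕ | ∃ n, ¬ (F (fun m => x (j, m)) n).Dom}) := by
  refine dense_iff_inter_open.2 fun U hU ⟨x, hx⟩ => ?_
  obtain ⟨I, u, hu, hIU⟩ := isOpen_pi_iff.1 hU x hx
  -- A fresh `n` leaves the entry `(i, n)` unconstrained by the basic neighbourhood. If the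
  -- computation on `n` can be made to halt, this entry is set to differ from its value, and column
  -- `j` is untouched because `i ≠ j`. Otherwise it diverges on a whole cylinder.
  obtain ⟨n, hn⟩ := Infinite.exists_notMem_finset (I.image Prod.snd)
  have hnI : (i, n) ∉ I := fun h => hn (Finset.mem_image.2 ⟨_, h, rfl⟩)
  by_cases h : ∃ x' ∈ U, (∀ p ∈ I, x' p = x p) ∧ (F (fun m => x' (j, m)) n).Dom
  · obtain ⟨x', -, hx'I, hdom⟩ := h
    obtain ⟨y, hy⟩ := Part.dom_iff_mem.1 hdom
    refine ⟨Function.update x' (i, n) (y + 1), hIU fun p hp => ?_, Or.inl ⟨n, y, ?_, by simp⟩⟩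
    · have hp' : p ≠ (i, n) := fun e => hnI (e ▸ hp)
      rw [Function.update_of_ne hp', hx'I p hp]
      exact (hu p hp).2
    · have e : (fun m => Function.update x' (i, n) (y + 1) (j, m)) = fun m => x' (j, m) :=
        funext fun m => Function.update_of_ne (by simp [hij.symm]) _ _
      rwa [e]
  · push Not at h
    refine ⟨x, hx, Or.inr (mem_interior.2 ⟨(I : Set (ℕ × ℕ)).pi fun p => {x p}, ?_, ?_, ?_⟩)⟩
    · intro x' hx'
      have hx'I : ∀ p ∈ I, x' p = x p := fun p hp => hx' p hp
      exact ⟨n, h x' (hIU fun p hp => hx'I p hp ▸ (hu p hp).2) hx'I⟩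
    · exact isOpen_set_pi I.finite_toSet fun p _ => isOpen_discrete _
    · exact fun p _ => rfl

/-- There are countably many requirements `(i, j, e)`, each met on a dense open set, so Baire's
theorem meets all of them at once; the functions are the columns of a generic point. -/
theorem exists_turing_antichain :
    ∃ h : ℕ → ℕ → ℕ, ∀ i j, i ≠ j → ¬ TuringReducible (h i : ℕ →. ℕ) (h j : ℕ →. ℕ) := by
  have hd := dense_iInter_of_isOpen
    (f := fun p : {p : ℕ × ℕ × ℕ // p.1 ≠ p.2.1} =>
      {x : ℕ × ℕ → ℕ | ∃ n, ∃ y ∈ turingPhi p.1.2.2 (fun m => x (p.1.2.1, m)) n,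
        y ≠ x (p.1.1, n)} ∪
      interior {x : ℕ × ℕ → ℕ | ∃ n, ¬ (turingPhi p.1.2.2 (fun m => x (p.1.2.1, m)) n).Dom})
    (fun p => (isOpen_setOf_exists_mem_ne (turingFunctional_iff.2 ⟨_, rfl⟩) _ _).union
      isOpen_interior)
    (fun p => dense_not_computes _ p.2)
  obtain ⟨x, hx⟩ := hd.nonempty
  refine ⟨fun i n => x (i, n), fun i j hij hred => ?_⟩
  obtain ⟨F, hF, e⟩ := exists_turingFunctional hred
  obtain ⟨c, rfl⟩ := turingFunctional_iff.1 hF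
  rcases Set.mem_iInter.1 hx ⟨(i, j, c), hij⟩ with ⟨n, y, hy, hne⟩ | h
  · rw [e] at hy
    exact hne (Part.mem_some_iff.1 hy)
  · obtain ⟨n, hn⟩ := interior_subset h
    exact hn (by rw [e]; trivial)

/-! ### Upwards closed mass problems -/

namespace MassProblem

/-- A mass problem is upwards closed under Turing reducibility. -/
def IsUpwardClosed (A : MassProblem) : Prop :=
  ∀ f ∈ A.sol, ∀ g : ℕ → ℕ, TuringReducible (f : ℕ →. ℕ) (g : ℕ →. ℕ) → g ∈ A.sol

theorem le_of_sol_subset {A B : MassProblem} (h : B.sol ⊆ A.sol) : A ≤ B :=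
  ⟨_, .oracle, fun g hg => ⟨g, h hg, rfl⟩⟩

/-- A solution computed from `g` lies Turing below `g`, so `g` itself is a solution and the identity
functional suffices. -/
theorem IsUpwardClosed.le_iff {A B : MassProblem} (hA : A.IsUpwardClosed) :
    A ≤ B ↔ B.sol ⊆ A.sol := by
  refine ⟨fun ⟨F, hF, h⟩ g hg => ?_, le_of_sol_subset⟩
  obtain ⟨f, hf, e⟩ := h g hg
  exact hA f hf g (hF.turingReducible e)

/-- The solutions that solve `B` together with every solution of `A`. -/
def relImp (A B : MassProblem) : MassProblem := ⟨{f | ∀ g ∈ A.sol, turingJoin g f ∈ B.sol}⟩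

theorem IsUpwardClosed.relImp (A : MassProblem) {B : MassProblem} (hB : B.IsUpwardClosed) :
    (A.relImp B).IsUpwardClosed := fun _ hf k hk g hg =>
  hB _ (hf g hg) _ (turingJoin_turingReducible (turingReducible_turingJoin_left g k)
    (hk.trans (turingReducible_turingJoin_right g k)))

theorem IsUpwardClosed.relImp_le_iff (A : MassProblem) {B : MassProblem}
    (hB : B.IsUpwardClosed) (C : MassProblem) : A.relImp B ≤ C ↔ B ≤ A.join C := by
  rw [(hB.relImp A).le_iff, hB.le_iff]
  constructor
  · rintro h _ ⟨g, hg, f, hf, rfl⟩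
    exact h hf g hg
  · exact fun h f hf g hg => h ⟨g, hg, f, hf, rfl⟩

end MassProblem

/-- `A.relImp B` has the universal property of `A.imp B` but needs no index of a functional, hence
is upwards closed. This makes negations in a Muchnik factor Muchnik. -/
theorem MedvedevDegree.IsMuchnik.sdiff {B : MedvedevDegree} (hB : B.IsMuchnik)
    (a : MedvedevDegree) : (B \ a).IsMuchnik := by
  obtain ⟨B, rfl, hB⟩ := hB
  induction a using MedvedevDegree.ind with
  | h A =>
  refine ⟨A.relImp B, le_antisymm ?_ ?_, MassProblem.IsUpwardClosed.relImp A hB⟩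
  · exact (MassProblem.IsUpwardClosed.relImp_le_iff A hB _).2
      ((MassProblem.imp_le_iff A B _).1 le_rfl)
  · exact (MassProblem.imp_le_iff A B _).2
      ((MassProblem.IsUpwardClosed.relImp_le_iff A hB _).1 le_rfl)

/-! ### Searching for a halting computation -/

/-- The finite string that interleaves `s` and `t`. -/
def interleave (s t : List ℕ) : List ℕ :=
  (List.range (2 * s.length)).map fun i =>
    if i % 2 = 0 then s.getD (i / 2) 0 else t.getD (i / 2) 0

theorem primrec_interleave : Primrec₂ interleave := by
  have hi : Primrec fun q : (List ℕ × List ℕ) × ℕ => q.2 / 2 :=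
    Primrec.nat_div.comp Primrec.snd (Primrec.const 2)
  refine Primrec.list_map (Primrec.list_range.comp (Primrec.nat_mul.comp (Primrec.const 2)
    (Primrec.list_length.comp Primrec.fst))) (Primrec.ite ?_ ?_ ?_)
  · exact Primrec.eq.comp (Primrec.nat_mod.comp Primrec.snd (Primrec.const 2)) (Primrec.const 0)
  · exact (Primrec.list_getD 0).comp (Primrec.fst.comp Primrec.fst) hi
  · exact (Primrec.list_getD 0).comp (Primrec.snd.comp Primrec.fst) hi

/-- Both strings have length `k`, so the default value `0` in `interleave` is never reached. -/
theorem interleave_initial_segments (g h : ℕ → ℕ) (k : ℕ) :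
    interleave ((List.range k).map g) ((List.range k).map h) =
      (List.range (2 * k)).map (turingJoin g h) := by
  simp only [interleave, List.length_map, List.length_range]
  refine List.map_congr_left fun i hi => ?_
  have hk : i / 2 < k := by have := List.mem_range.1 hi; omega
  simp [turingJoin, List.getD, hk]

/-- One can search, uniformly in `h`, for a finite string `s` such that the computation of `F` with
oracle `g ⊕ h` on the input `0` halts with the same value for all `g` extending `s`. -/
theorem TuringFunctional.exists_search {F : (ℕ → ℕ) → ℕ →. ℕ} (hF : TuringFunctional F) :
    ∃ S T, TuringFunctional S ∧ TuringFunctional T ∧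
      ∀ h, (∃ g, (F (turingJoin g h) 0).Dom) → ∃ (s : List ℕ) (y : ℕ),
        S h 0 = Part.some (Encodable.encode s) ∧ T h 0 = Part.some y ∧
        ∀ g, (List.range s.length).map g = s → y ∈ F (turingJoin g h) 0 := by
  obtain ⟨φ, cφ, sφ, tφ⟩ := hF.exists_approx
  have hn : Nat.Partrec fun q => φ (Denumerable.ofNat (List ℕ) q) 0 := by
    refine Partrec.nat_iff.1 (Partrec₂.comp cφ ?_ (Computable.const 0))
    exact (Primrec.ofNat _).to_comp
  obtain ⟨c, hc⟩ := Nat.Partrec.Code.exists_code.1 hn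
  -- The search variable `k` codes a step bound and a candidate string.
  let σ : ℕ → List ℕ := fun k => Denumerable.ofNat (List ℕ) k.unpair.2
  let v : (ℕ → ℕ) → ℕ → Option ℕ := fun h k => Nat.Partrec.Code.evaln k.unpair.1 c
    (Encodable.encode (interleave (σ k) ((List.range (σ k).length).map h)))
  let w : ℕ → ℕ := fun q => Encodable.encode (Nat.Partrec.Code.evaln q.unpair.1.unpair.1 c
    (Encodable.encode (interleave (σ q.unpair.1) (Denumerable.ofNat (List ℕ) q.unpair.2))))
  have l : Primrec fun q : ℕ => q.unpair.1 := Primrec.fst.comp Primrec.unpair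
  have r : Primrec fun q : ℕ => q.unpair.2 := Primrec.snd.comp Primrec.unpair
  have hσ : Primrec σ := (Primrec.ofNat _).comp r
  have hw : Computable w := Primrec.to_comp <| Primrec.encode.comp <|
    Nat.Partrec.Code.primrec_evaln.comp <| ((l.comp l).pair (Primrec.const c)).pair <|
    Primrec.encode.comp <| primrec_interleave.comp (hσ.comp l) ((Primrec.ofNat _).comp r)
  have hv : TuringFunctional fun h k => Part.some (Encodable.encode (v h k)) := by
    refine ((of_computable hw).comp_total (pair_total (of_computable Computable.id)
      (initial_segment.comp_computable
        (Primrec.list_length.comp hσ).to_comp))).of_eq fun h k => ?_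
    simp [w, v]
  -- `none` has code `0` and `some y` has code `y + 1`, so `1 - m` vanishes exactly at codes of
  -- halting runs, and the predecessor later recovers `y`.
  have hs : Computable fun m : ℕ => 1 - m :=
    (Primrec.nat_sub.comp (Primrec.const 1) Primrec.id).to_comp
  have h1 := ((of_computable hs).comp_total (hv.comp_computable r.to_comp)).rfind
  refine ⟨_, _, (of_computable r.to_comp).comp h1,
    (of_computable Primrec.pred.to_comp).comp (hv.comp h1), ?_⟩
  rintro h ⟨g, hg⟩
  obtain ⟨y₀, hy₀⟩ := Part.dom_iff_mem.1 hg
  -- A long enough initial segment of the given `g` is a successful candidate.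
  have hex : ∃ k, (v h k).isSome := by
    obtain ⟨m, hm⟩ := Filter.eventually_atTop.1 (tφ _ _ _ hy₀)
    have h2 : y₀ ∈ c.eval
        (Encodable.encode (interleave ((List.range m).map g) ((List.range m).map h))) := by
      rw [hc, interleave_initial_segments]
      simpa using hm (2 * m) (by omega)
    obtain ⟨t, ht⟩ := Nat.Partrec.Code.evaln_complete.1 h2
    refine ⟨Nat.pair t (Encodable.encode ((List.range m).map g)), ?_⟩
    have ht' := Option.mem_def.1 ht
    simp [v, σ, ht']
  have hfind : ∀ a, (Nat.rfind fun n => (Part.some (1 - Encodable.encode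
      (v h (Nat.pair a n).unpair.2)) : Part ℕ).map fun m => decide (m = 0)) =
      Part.some (Nat.find hex) := by
    intro a
    refine Part.eq_some_iff.2 (Nat.mem_rfind.2 ⟨?_, fun {m} hm => ?_⟩)
    · obtain ⟨z, hz⟩ := Option.isSome_iff_exists.1 (Nat.find_spec hex)
      simp [hz]
    · have := Nat.find_min hex hm
      simp only [Option.not_isSome_iff_eq_none] at this
      simp [this]
  obtain ⟨y, hy⟩ := Option.isSome_iff_exists.1 (Nat.find_spec hex)
  refine ⟨σ (Nat.find hex), y, ?_, ?_, fun g' hg' => ?_⟩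
  · simp only [hfind, Part.bind_some]
    simp [σ]
  · simp only [hfind, Part.bind_some, hy]
    simp
  · have h3 := Nat.Partrec.Code.evaln_sound hy
    rw [← hg', hc, List.length_map, List.length_range, interleave_initial_segments] at h3
    simp only [Denumerable.ofNat_encode] at h3
    exact sφ _ _ _ _ h3

/-! ### Upwards closed problems as premises -/

/-- The concatenation of the finite string with code `a` and the infinite string `f`. -/
def stringAppend (a : ℕ) (f : ℕ → ℕ) : ℕ → ℕ := fun n =>
  (Denumerable.ofNat (List ℕ) a)[n]?.getD (f (n - (Denumerable.ofNat (List ℕ) a).length))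

theorem range_map_stringAppend (s : List ℕ) (f : ℕ → ℕ) :
    (List.range s.length).map (stringAppend (Encodable.encode s) f) = s := by
  refine List.ext_getElem (by simp) fun i h1 h2 => ?_
  simp [stringAppend, h2]

theorem turingReducible_stringAppend (a : ℕ) (f : ℕ → ℕ) :
    TuringReducible (f : ℕ →. ℕ) (stringAppend a f : ℕ →. ℕ) := by
  have hc : Computable fun n : ℕ => n + (Denumerable.ofNat (List ℕ) a).length :=
    (Primrec.nat_add.comp Primrec.id (Primrec.const _)).to_comp
  exact (TuringFunctional.oracle.comp_computable hc).turingReducible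
    (funext fun n => by simp [stringAppend])

/-- The functional that takes `g ⊕ (a ⌢ h)` to `(s ⌢ g) ⊕ h`, where `s` is the string with
code `a`. -/
theorem exists_append_functional : ∃ H, TuringFunctional H ∧ ∀ a g h,
    H (turingJoin g (stringCons a h)) = (turingJoin (stringAppend a g) h : ℕ →. ℕ) := by
  let c : ℕ → ℕ := fun q =>
    (Denumerable.ofNat (List ℕ) q.unpair.1.unpair.1)[q.unpair.1.unpair.2]?.getD q.unpair.2
  -- In the oracle `g ⊕ (a ⌢ h)`, `g m` stands at `2 * m`, `a` at `1` and `h m` at `2 * m + 3`.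
  let d : ℕ → ℕ := fun q => 2 * (q.unpair.2 - (Denumerable.ofNat (List ℕ) q.unpair.1).length)
  have l : Primrec fun q : ℕ => q.unpair.1 := Primrec.fst.comp Primrec.unpair
  have r : Primrec fun q : ℕ => q.unpair.2 := Primrec.snd.comp Primrec.unpair
  have hc : Computable c := Primrec.to_comp <| Primrec.option_getD.comp
    (Primrec.list_getElem?.comp ((Primrec.ofNat _).comp (l.comp l)) (r.comp l)) r
  have hd : Computable d := Primrec.to_comp <| Primrec.nat_mul.comp (Primrec.const 2) <|
    Primrec.nat_sub.comp r (Primrec.list_length.comp ((Primrec.ofNat _).comp l))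
  have ho : Computable fun n : ℕ => 2 * n + 3 := Primrec.to_comp <|
    Primrec.nat_add.comp (Primrec.nat_mul.comp (Primrec.const 2) Primrec.id) (Primrec.const 3)
  have h1 : TuringFunctional fun w _ => Part.some (w 1) :=
    TuringFunctional.oracle.comp_computable (Computable.const 1)
  have h2 := h1.pair_total (TuringFunctional.of_computable Computable.id)
  have h3 := (TuringFunctional.of_computable hc).comp_total (h2.pair_total
    (TuringFunctional.oracle.comp_total ((TuringFunctional.of_computable hd).comp_total h2)))
  refine ⟨_, MassProblem.join_functional h3 (TuringFunctional.oracle.comp_computable ho),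
    fun a g h => funext fun n => ?_⟩
  have e1 : turingJoin g (stringCons a h) 1 = a := MassProblem.turingJoin_odd g _ 0
  have e2 : ∀ m, turingJoin g (stringCons a h) (2 * m + 3) = h m := fun m =>
    (MassProblem.turingJoin_odd g _ (m + 1)).trans (MassProblem.tail_cons a h m)
  by_cases hn : n % 2 = 0
  · simp only [hn, e1, d, c, id, Nat.unpair_pair, turingJoin_even, if_true]
    simp [turingJoin, stringAppend, hn]
  · simp [hn, e2, turingJoin.eq_def (stringAppend a g)]

/-- For `k` in `C`, search for a string `s` that fixes the first value of the reduction for every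
oracle `g ⊕ k` with `g` extending `s`; a solution of `D` guarantees success. Prepending `s` keeps
solutions of `D` in `D`, so that value decides between `Q` and `R` independently of the solution
supplied. -/
theorem MassProblem.IsUpwardClosed.exists_split {D Q R C : MassProblem} (hD : D.IsUpwardClosed)
    (hne : D.sol.Nonempty) (h : Q.meet R ≤ D.join C) :
    ∃ C₀ C₁ : MassProblem, C₀.meet C₁ ≤ C ∧ Q ≤ D.join C₀ ∧ R ≤ D.join C₁ := by
  obtain ⟨F, hF, hFC⟩ := h
  obtain ⟨S, T, hS, hT, hST⟩ := hF.exists_search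
  obtain ⟨g₀, hg₀⟩ := hne
  obtain ⟨H, hH, eH⟩ := exists_append_functional
  obtain ⟨K, hK, eK⟩ := hF.exists_comp hH
  -- The code of `s` is stored in front of `k` so that the reductions of `Q` and `R` can read and
  -- prepend it.
  let E : ℕ → MassProblem := fun i => ⟨{f | ∃ (s : List ℕ), ∃ k ∈ C.sol,
    f = stringCons (Encodable.encode s) k ∧
      ∀ g, (List.range s.length).map g = s → i ∈ F (turingJoin g k) 0}⟩
  have hE : ∀ i, ∀ f ∈ (D.join (E i)).sol, ∃ k, stringCons i k ∈ (Q.meet R).sol ∧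
      (fun n => K f (n + 1)) = (k : ℕ →. ℕ) := by
    rintro i _ ⟨g, hg, _, ⟨s, k, hk, rfl, hs⟩, rfl⟩
    have hg' := hD g hg _ (turingReducible_stringAppend (Encodable.encode s) g)
    obtain ⟨f, hf, e⟩ := hFC _ ⟨_, hg', k, hk, rfl⟩
    have h0 := hs _ (range_map_stringAppend s g)
    rw [e] at h0
    refine ⟨fun n => f (n + 1), ?_, funext fun n => ?_⟩
    · convert hf
      funext n
      cases n with
      | zero => exact Part.mem_some_iff.1 h0
      | succ n => exact tail_cons _ _ _
    · rw [eK _ _ (eH _ _ _), e]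
      rfl
  have inj : ∀ {a b : ℕ} {f k : ℕ → ℕ}, stringCons a f = stringCons b k → a = b ∧ f = k := by
    intro a b f k e
    refine ⟨congrFun e 0, funext fun n => ?_⟩
    simpa only [tail_cons] using congrFun e (n + 1)
  refine ⟨E 0, E 1, ?_, ?_, ?_⟩
  · have hp : Computable fun n : ℕ => n - 1 := Primrec.pred.to_comp
    -- The output is `y`, then the code of `s`, then `k`: positions `0` and `1` come from the
    -- search, and position `n + 2` copies `k n`.
    have hN := TuringFunctional.ite (hT.comp_computable (Computable.const 0))
      ((TuringFunctional.ite (hS.comp_computable (Computable.const 0))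
        (TuringFunctional.oracle.comp_computable hp)
        (TuringFunctional.of_computable Computable.id)).comp_computable hp)
      (TuringFunctional.of_computable Computable.id)
    refine ⟨_, hN, fun k hk => ?_⟩
    obtain ⟨f, hf, e⟩ := hFC _ ⟨g₀, hg₀, k, hk, rfl⟩
    obtain ⟨s, y, eS, eT, hs⟩ := hST k ⟨g₀, by rw [e]; trivial⟩
    refine ⟨stringCons y (stringCons (Encodable.encode s) k), ?_, funext fun n => ?_⟩
    · have hmem : stringCons (Encodable.encode s) k ∈ (E y).sol := ⟨s, k, hk, rfl, hs⟩
      -- This shows that `y` is `0` or `1`: it is the head of a solution of `Q.meet R`.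
      obtain ⟨q, hq, -⟩ := hE y _ ⟨g₀, hg₀, _, hmem, rfl⟩
      rcases hq with ⟨_, _, e'⟩ | ⟨_, _, e'⟩
      · obtain ⟨rfl, -⟩ := inj e'
        exact Or.inl ⟨_, hmem, rfl⟩
      · obtain ⟨rfl, -⟩ := inj e'
        exact Or.inr ⟨_, hmem, rfl⟩
    · rcases n with _ | _ | n <;> simp [stringCons, eS, eT]
  · refine ⟨_, hK.comp_computable Computable.succ, fun f hf => ?_⟩
    obtain ⟨k, ⟨q, hq, e⟩ | ⟨q, hq, e⟩, ek⟩ := hE 0 f hf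
    · exact ⟨k, (inj e).2 ▸ hq, ek⟩
    · exact absurd (inj e).1 one_ne_zero
  · refine ⟨_, hK.comp_computable Computable.succ, fun f hf => ?_⟩
    obtain ⟨k, ⟨q, hq, e⟩ | ⟨q, hq, e⟩, ek⟩ := hE 1 f hf
    · exact absurd (inj e).1 zero_ne_one
    · exact ⟨k, (inj e).2 ▸ hq, ek⟩

/-! ### Muchnik degrees: distribution over meets and primeness -/

namespace MedvedevDegree

theorem IsMuchnik.inf_sdiff_le {d : MedvedevDegree} (hd : d.IsMuchnik) (x y : MedvedevDegree) :
    x \ d ⊓ y \ d ≤ (x ⊓ y) \ d := by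
  obtain ⟨D, rfl, hD⟩ := hd
  induction x using ind with
  | h Q =>
  induction y using ind with
  | h R =>
  rcases D.sol.eq_empty_or_nonempty with h0 | hne
  · have ht : deg D = ⊤ := top_unique
      (MassProblem.le_of_sol_subset (A := ⟨∅⟩) (B := D) h0.subset)
    simp [ht]
  · obtain ⟨C₀, C₁, h, h₀, h₁⟩ := MassProblem.IsUpwardClosed.exists_split hD hne
      ((MassProblem.imp_le_iff D (Q.meet R) _).1 le_rfl)
    have h₀' : deg Q \ deg D ≤ deg C₀ := (MassProblem.imp_le_iff D Q C₀).2 h₀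
    have h₁' : deg R \ deg D ≤ deg C₁ := (MassProblem.imp_le_iff D R C₁).2 h₁
    exact (inf_le_inf h₀' h₁').trans h

/-- Running the reduction on the zero function yields a computable solution of the meet; its head
selects the side and its tail is a computable solution there. -/
theorem le_bot_or_le_bot_of_inf_le_bot {x y : MedvedevDegree} (h : x ⊓ y ≤ ⊥) :
    x ≤ ⊥ ∨ y ≤ ⊥ := by
  induction x using ind with
  | h Q =>
  induction y using ind with
  | h R =>
  obtain ⟨F, hF, h⟩ : Q.meet R ≤ ⟨Set.univ⟩ := h
  obtain ⟨K, hK, eK⟩ := hF.exists_comp TuringFunctional.zero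
  have hc : ∀ A : MassProblem, ∀ a, ∀ f ∈ A.sol,
      F (fun _ => 0) = (stringCons a f : ℕ →. ℕ) → A ≤ ⟨Set.univ⟩ := fun A a f hf e =>
    ⟨_, hK.comp_computable Computable.succ, fun g _ => ⟨f, hf, funext fun n => by
      rw [eK g (fun _ => 0) rfl, e]
      exact congrArg Part.some (MassProblem.tail_cons a f n)⟩⟩
  obtain ⟨_, ⟨f, hf, rfl⟩ | ⟨f, hf, rfl⟩, e⟩ := h (fun _ => 0) trivial
  · exact Or.inl (hc Q 0 f hf e)
  · exact Or.inr (hc R 1 f hf e)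

theorem IsMuchnik.le_or_le_of_inf_le {d : MedvedevDegree} (hd : d.IsMuchnik)
    {x y : MedvedevDegree} (h : x ⊓ y ≤ d) : x ≤ d ∨ y ≤ d := by
  have h' : x \ d ⊓ y \ d ≤ ⊥ :=
    (hd.inf_sdiff_le x y).trans (sdiff_eq_bot_iff.2 h).le
  simpa only [le_bot_iff, sdiff_eq_bot_iff] using le_bot_or_le_bot_of_inf_le_bot h'

end MedvedevDegree

/-! ### Embedding the algebras of finite problems -/

section Embedding

variable {n : ℕ} {L : Type*} [CoheytingAlgebra L]

namespace MedvedevAlgebra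

/-- The simplices of `X`, where the empty set counts as a simplex. -/
def simplices (X : MedvedevAlgebra n) : Set (Finset (Fin n)) :=
  {s | ∀ h : s.Nonempty, OrderDual.toDual ⟨s, h⟩ ∈ X}

/-- Counting `∅` keeps the meets over simplices nonempty and lets `⊤`, whose only simplex is `∅`, go
to `a ∅`. -/
theorem empty_mem_simplices (X : MedvedevAlgebra n) : ∅ ∈ X.simplices := fun h => by simp at h

theorem mem_simplices_of_subset {X : MedvedevAlgebra n} {s t : Finset (Fin n)}
    (ht : t ∈ X.simplices) (h : s ⊆ t) : s ∈ X.simplices := fun hs =>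
  X.upper (show OrderDual.toDual (⟨t, hs.mono h⟩ : {s : Finset (Fin n) // s.Nonempty}) ≤ _ from h)
    (ht (hs.mono h))

theorem le_iff_simplices_subset {X Y : MedvedevAlgebra n} :
    X ≤ Y ↔ Y.simplices ⊆ X.simplices :=
  ⟨fun h _ hs hn => h (hs hn), fun h p hp => h (fun _ => hp : (OrderDual.ofDual p).1 ∈ _) _⟩

theorem simplices_sup (X Y : MedvedevAlgebra n) :
    (X ⊔ Y).simplices = X.simplices ∩ Y.simplices :=
  Set.ext fun _ => forall_and

theorem simplices_inf (X Y : MedvedevAlgebra n) :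
    (X ⊓ Y).simplices = X.simplices ∪ Y.simplices := by
  ext s
  rcases s.eq_empty_or_nonempty with rfl | hs
  · simp [empty_mem_simplices]
  · simp [simplices, hs]

/-- The complex of all `u` such that `u ∩ s` is a simplex of `Y`. -/
def relativize (Y : MedvedevAlgebra n) (s : Finset (Fin n)) : MedvedevAlgebra n where
  carrier := {p | (OrderDual.ofDual p).1 ∩ s ∈ Y.simplices}
  upper' := fun _ _ h hp => mem_simplices_of_subset hp (Finset.inter_subset_inter_right h)

theorem mem_simplices_relativize {Y : MedvedevAlgebra n} {s u : Finset (Fin n)} :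
    u ∈ (Y.relativize s).simplices ↔ u ∩ s ∈ Y.simplices := by
  rcases u.eq_empty_or_nonempty with rfl | hu
  · simp [empty_mem_simplices]
  · exact ⟨fun h => h hu, fun h _ => h⟩

open Classical in
/-- The meet of the elements that `a` assigns to the simplices. -/
noncomputable def evalSimplices (a : Finset (Fin n) → L) (X : MedvedevAlgebra n) : L :=
  (Finset.univ.filter (· ∈ X.simplices)).inf a

theorem evalSimplices_le {a : Finset (Fin n) → L} {X : MedvedevAlgebra n} {s : Finset (Fin n)}
    (hs : s ∈ X.simplices) : evalSimplices a X ≤ a s :=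
  Finset.inf_le (by simpa using hs)

theorem le_evalSimplices {a : Finset (Fin n) → L} {X : MedvedevAlgebra n} {z : L} :
    z ≤ evalSimplices a X ↔ ∀ s ∈ X.simplices, z ≤ a s := by
  simp [evalSimplices, Finset.le_inf_iff]

theorem evalSimplices_mono (a : Finset (Fin n) → L) : Monotone (evalSimplices a) := fun _ _ h =>
  le_evalSimplices.2 fun _ hs => evalSimplices_le (le_iff_simplices_subset.1 h hs)

theorem evalSimplices_inf (a : Finset (Fin n) → L) (X Y : MedvedevAlgebra n) :
    evalSimplices a (X ⊓ Y) = evalSimplices a X ⊓ evalSimplices a Y := by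
  refine le_antisymm ((evalSimplices_mono a).map_inf_le X Y) (le_evalSimplices.2 fun s hs => ?_)
  rw [simplices_inf] at hs
  exact hs.elim (fun h => inf_le_left.trans (evalSimplices_le h))
    fun h => inf_le_right.trans (evalSimplices_le h)

/-- By distributivity a join of two meets is the meet of all `a s ⊔ a t = a (s ∩ t)`, and `s ∩ t` is
a simplex of both complexes. -/
theorem evalSimplices_sup {a : Finset (Fin n) → L} (ha : ∀ s t, a (s ∩ t) = a s ⊔ a t)
    (X Y : MedvedevAlgebra n) :
    evalSimplices a (X ⊔ Y) = evalSimplices a X ⊔ evalSimplices a Y := by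
  refine le_antisymm ?_ ((evalSimplices_mono a).le_map_sup X Y)
  rw [evalSimplices, evalSimplices, evalSimplices, Finset.inf_sup_distrib_right]
  refine Finset.le_inf fun s hs => ?_
  rw [Finset.inf_sup_distrib_left]
  refine Finset.le_inf fun t ht => ?_
  rw [← ha]
  refine evalSimplices_le ?_
  rw [simplices_sup]
  exact ⟨mem_simplices_of_subset (by simpa using hs) Finset.inter_subset_left,
    mem_simplices_of_subset (by simpa using ht) Finset.inter_subset_right⟩

/-- Nonemptiness matters: the empty meet would require `⊤ ≤ ⊤ \ d`. -/
theorem inf_sdiff_le_of_binary {d : L} (hd : ∀ x y, x \ d ⊓ y \ d ≤ (x ⊓ y) \ d)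
    {ι : Type*} (s : Finset ι) (hs : s.Nonempty) (f : ι → L) :
    (s.inf fun i => f i \ d) ≤ s.inf f \ d := by
  classical
  induction hs using Finset.Nonempty.cons_induction with
  | singleton i => simp
  | cons i s hi hs ih =>
    rw [Finset.inf_cons, Finset.inf_cons]
    exact (inf_le_inf_left _ ih).trans (hd _ _)

/-- `Y \ X` is bounded by the join of the complexes `Y.relativize s` over simplices `s` of `X`. For
a simplex `t` of `Y`, `t ∪ sᶜ` belongs to `Y.relativize s`, so `hsd` bounds the image of this
complex by each `a t \ a s`, and `hkp` moves the meet over `t` inside the difference. -/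
theorem evalSimplices_sdiff {a : Finset (Fin n) → L} (ha : ∀ s t, a (s ∩ t) = a s ⊔ a t)
    (hsd : ∀ s t, a (t ∪ sᶜ) ≤ a t \ a s)
    (hkp : ∀ s x y, x \ a s ⊓ y \ a s ≤ (x ⊓ y) \ a s) (Y X : MedvedevAlgebra n) :
    evalSimplices a (Y \ X) = evalSimplices a Y \ evalSimplices a X := by
  classical
  refine le_antisymm ?_ ?_
  · have hbot : evalSimplices a (⊥ : MedvedevAlgebra n) = ⊥ := by
      refine le_bot_iff.1 ((evalSimplices_le (X := ⊥) (s := ∅ ∪ ∅ᶜ) fun _ => trivial).trans ?_)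
      exact (hsd ∅ ∅).trans sdiff_self.le
    let f : SupBotHom (MedvedevAlgebra n) L := ⟨⟨evalSimplices a, evalSimplices_sup ha⟩, hbot⟩
    -- A simplex `u` of `X` and of the join is tested against the index `s = u`, where `u ∩ u = u`.
    have h1 : Y \ X ≤ (Finset.univ.filter (· ∈ X.simplices)).sup fun s => Y.relativize s := by
      rw [sdiff_le_iff, le_iff_simplices_subset, simplices_sup]
      rintro u ⟨hu, hu'⟩
      have h2 := le_iff_simplices_subset.1 (Finset.le_sup (f := fun s => Y.relativize s)
        (show u ∈ Finset.univ.filter (· ∈ X.simplices) by simpa using hu)) hu'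
      simpa [mem_simplices_relativize] using h2
    refine (evalSimplices_mono a h1).trans ?_
    refine (map_finset_sup f _ _).le.trans (Finset.sup_le fun s hs => ?_)
    have hs' : s ∈ X.simplices := by simpa using hs
    refine le_trans ?_ (sdiff_le_sdiff_left (evalSimplices_le hs'))
    refine le_trans ?_ (inf_sdiff_le_of_binary (hkp s) _ ⟨∅, by simp [empty_mem_simplices]⟩ a)
    refine Finset.le_inf fun t ht => (evalSimplices_le ?_).trans (hsd s t)
    rw [mem_simplices_relativize, Finset.union_inter_distrib_right, Finset.inter_comm sᶜ,
      Finset.inter_compl, Finset.union_empty]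
    exact mem_simplices_of_subset (by simpa using ht) Finset.inter_subset_left
  · rw [sdiff_le_iff, ← evalSimplices_sup ha]
    exact evalSimplices_mono a le_sup_sdiff

/-- The map reflects the order: if the image of `X` is below `a t` with `t` a simplex of `Y`,
primeness gives a simplex `s` of `X` with `a s ≤ a t`, hence `t ⊆ s` is a simplex of `X`. -/
theorem evalSimplices_injective {a : Finset (Fin n) → L}
    (hle : ∀ s t, a s ≤ a t → t ⊆ s)
    (hprime : ∀ s x y, x ⊓ y ≤ a s → x ≤ a s ∨ y ≤ a s) :
    Function.Injective (evalSimplices a) := by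
  classical
  have hfin : ∀ (S : Finset (Finset (Fin n))), S.Nonempty → ∀ t, S.inf a ≤ a t →
      ∃ s ∈ S, a s ≤ a t := by
    intro S hS t
    induction hS using Finset.Nonempty.cons_induction with
    | singleton i => simp
    | cons i S hi hS ih =>
      intro h
      rw [Finset.inf_cons] at h
      rcases hprime t _ _ h with h | h
      · exact ⟨i, by simp, h⟩
      · obtain ⟨s, hs, h'⟩ := ih h
        exact ⟨s, by simp [hs], h'⟩
  have key : ∀ X Y : MedvedevAlgebra n, evalSimplices a X ≤ evalSimplices a Y → X ≤ Y := by
    refine fun X Y h => le_iff_simplices_subset.2 fun t ht => ?_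
    obtain ⟨s, hs, h'⟩ := hfin _ ⟨∅, by simp [empty_mem_simplices]⟩ t
      (h.trans (evalSimplices_le ht))
    exact mem_simplices_of_subset (by simpa using hs) (hle s t h')
  exact fun X Y h => le_antisymm (key X Y h.le) (key Y X h.ge)

/-- A sufficient condition for the embeddability of `MedvedevAlgebra n`. -/
theorem bEmbeddable_of_simplices (a : Finset (Fin n) → L) (htop : a ∅ = ⊤)
    (ha : ∀ s t, a (s ∩ t) = a s ⊔ a t) (hsd : ∀ s t, a (t ∪ sᶜ) ≤ a t \ a s)
    (hkp : ∀ s x y, x \ a s ⊓ y \ a s ≤ (x ⊓ y) \ a s) (hle : ∀ s t, a s ≤ a t → t ⊆ s)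
    (hprime : ∀ s x y, x ⊓ y ≤ a s → x ≤ a s ∨ y ≤ a s) :
    BEmbeddable (MedvedevAlgebra n) L := by
  refine ⟨⟨⟨⟨evalSimplices a, evalSimplices_sup ha⟩, evalSimplices_inf a⟩, ?_,
    evalSimplices_sdiff ha hsd hkp⟩, evalSimplices_injective hle hprime⟩
  change evalSimplices a ⊤ = ⊤
  refine top_unique (le_evalSimplices.2 fun s hs => ?_)
  rcases s.eq_empty_or_nonempty with rfl | hs'
  · exact htop.ge
  · exact (hs hs').elim

end MedvedevAlgebra

end Embedding

/-! ### Soundness -/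

namespace PropForm

theorem eval_subst {L : Type*} [CoheytingAlgebra L] (σ : ℕ → PropForm) (v : ℕ → L)
    (φ : PropForm) : (subst σ φ).eval v = φ.eval fun i => (σ i).eval v := by
  induction φ with
  | var i => rfl
  | and φ ψ h1 h2 => simp only [subst, eval, h1, h2]
  | or φ ψ h1 h2 => simp only [subst, eval, h1, h2]
  | imp φ ψ h1 h2 => simp only [subst, eval, h1, h2]
  | neg φ h1 => simp only [subst, eval, h1]

theorem eval_map {L₁ L₂ : Type*} [CoheytingAlgebra L₁] [CoheytingAlgebra L₂]
    (f : CoheytingHom L₁ L₂) (v : ℕ → L₁) (φ : PropForm) :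
    φ.eval (fun i => f (v i)) = f (φ.eval v) := by
  induction φ with
  | var i => rfl
  | and φ ψ h1 h2 => simp only [eval, h1, h2, map_sup]
  | or φ ψ h1 h2 => simp only [eval, h1, h2, map_inf]
  | imp φ ψ h1 h2 => simp only [eval, h1, h2, map_sdiff]
  | neg φ h1 => simp only [eval, h1, map_sdiff, map_top]

/-- An implication takes the value `⊥` exactly when its conclusion is below its premise, so each
axiom becomes an inequality. -/
theorem Derivable.eval_eq_bot {L : Type*} [CoheytingAlgebra L] {Γ : Set PropForm}
    (hΓ : Γ ⊆ BrouwerTheory L) {φ : PropForm} (h : Derivable Γ φ) (v : ℕ → L) :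
    φ.eval v = ⊥ := by
  induction h with
  | extra σ hφ => rw [eval_subst]; exact hΓ hφ _
  | mp _ _ h1 h2 => simpa only [eval, h2, sdiff_bot] using h1
  | k φ ψ => simpa only [eval, sdiff_eq_bot_iff] using sdiff_le
  | s φ ψ χ =>
    simp only [eval, sdiff_eq_bot_iff]
    rw [sdiff_le_iff, sdiff_le_iff]
    have h1 : eval v χ ≤ eval v ψ ⊔ (eval v φ ⊔ (eval v χ \ eval v ψ) \ eval v φ) :=
      le_sup_sdiff.trans (sup_le_sup_left le_sup_sdiff _)
    refine h1.trans (sup_le (le_sup_sdiff.trans (sup_le_sup_left le_sup_left _)) ?_)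
    exact sup_le_sup_left le_sup_right _
  | and_left φ ψ => simpa only [eval, sdiff_eq_bot_iff] using le_sup_left
  | and_right φ ψ => simpa only [eval, sdiff_eq_bot_iff] using le_sup_right
  | and_intro φ ψ =>
    simp only [eval, sdiff_eq_bot_iff]
    rw [sdiff_le_iff, sup_comm]
  | or_left φ ψ => simpa only [eval, sdiff_eq_bot_iff] using inf_le_left
  | or_right φ ψ => simpa only [eval, sdiff_eq_bot_iff] using inf_le_right
  | or_elim φ ψ χ =>
    simp only [eval, sdiff_eq_bot_iff]
    rw [sdiff_le_iff, sdiff_inf, sup_comm]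
  | neg_intro φ ψ =>
    simp only [eval, sdiff_eq_bot_iff]
    rw [sdiff_le_iff, sdiff_le_iff]
    have h1 : (⊤ : L) ≤ eval v ψ ⊔ (eval v φ ⊔ (⊤ \ eval v ψ) \ eval v φ) :=
      le_sup_sdiff.trans (sup_le_sup_left le_sup_sdiff _)
    refine h1.trans (sup_le (le_sup_sdiff.trans (sup_le_sup_left le_sup_right _)) ?_)
    exact sup_le_sup_left le_sup_left _
  | neg_elim φ ψ =>
    simp only [eval, sdiff_eq_bot_iff]
    exact sdiff_le_sdiff_right le_top

theorem kreiselPutnam_mem_brouwerTheory {L : Type*} [CoheytingAlgebra L]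
    (h : ∀ p x y : L, x \ (⊤ \ p) ⊓ y \ (⊤ \ p) ≤ (x ⊓ y) \ (⊤ \ p)) :
    kreiselPutnam ∈ BrouwerTheory L := fun v => by
  simpa only [kreiselPutnam, eval, sdiff_eq_bot_iff] using h _ _ _

end PropForm

theorem BEmbeddable.brouwerTheory_subset {L₁ L₂ : Type*} [CoheytingAlgebra L₁]
    [CoheytingAlgebra L₂] (h : BEmbeddable L₁ L₂) : BrouwerTheory L₂ ⊆ BrouwerTheory L₁ := by
  obtain ⟨f, hf⟩ := h
  intro φ hφ v
  apply hf
  rw [← PropForm.eval_map, hφ, map_bot]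

/-! ### The Muchnik degree of an antichain -/

/-- The functions that are not computable from any `h i` with `i ∈ S`. -/
def avoidCones (h : ℕ → ℕ → ℕ) (S : Set ℕ) : MassProblem :=
  ⟨{g | ∀ i ∈ S, ¬ TuringReducible (g : ℕ →. ℕ) (h i : ℕ →. ℕ)}⟩

section AvoidCones

variable {h : ℕ → ℕ → ℕ}

theorem isUpwardClosed_avoidCones (h : ℕ → ℕ → ℕ) (S : Set ℕ) :
    (avoidCones h S).IsUpwardClosed :=
  fun _ hf _ hfg i hi hg => hf i hi (hfg.trans hg)

theorem isMuchnik_avoidCones (h : ℕ → ℕ → ℕ) (S : Set ℕ) :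
    (MedvedevDegree.deg (avoidCones h S)).IsMuchnik :=
  ⟨_, rfl, isUpwardClosed_avoidCones h S⟩

theorem avoidCones_mono (h : ℕ → ℕ → ℕ) {S T : Set ℕ} (hST : S ⊆ T) :
    avoidCones h S ≤ avoidCones h T :=
  MassProblem.le_of_sol_subset fun _ hg i hi => hg i (hST hi)

/-- For `j ∈ T \ S` the antichain makes `h j` a solution of `avoidCones h S`. If `c` were computable
from `h j`, so would be `h j ⊕ c`, which is required to avoid that cone. -/
theorem avoidCones_le_join_iff (hh : ∀ i j, i ≠ j →
      ¬ TuringReducible (h i : ℕ →. ℕ) (h j : ℕ →. ℕ))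
    {S T : Set ℕ} {C : MassProblem} :
    avoidCones h T ≤ (avoidCones h S).join C ↔ avoidCones h (T \ S) ≤ C := by
  rw [(isUpwardClosed_avoidCones h _).le_iff, (isUpwardClosed_avoidCones h _).le_iff]
  constructor
  · intro hT c hc j hj hcj
    refine hT ⟨h j, fun i hi => hh j i ?_, c, hc, rfl⟩ j hj.1
      (turingJoin_turingReducible (.refl _) hcj)
    rintro rfl
    exact hj.2 hi
  · rintro hT _ ⟨g, hg, c, hc, rfl⟩ j hj hred
    by_cases hjS : j ∈ S
    · exact hg j hjS ((turingReducible_turingJoin_left g c).trans hred)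
    · exact hT hc j ⟨hj, hjS⟩ ((turingReducible_turingJoin_right g c).trans hred)

theorem deg_avoidCones_sdiff (hh : ∀ i j, i ≠ j →
      ¬ TuringReducible (h i : ℕ →. ℕ) (h j : ℕ →. ℕ)) (S T : Set ℕ) :
    MedvedevDegree.deg (avoidCones h T) \ MedvedevDegree.deg (avoidCones h S) =
      MedvedevDegree.deg (avoidCones h (T \ S)) := by
  refine eq_of_forall_ge_iff (MedvedevDegree.ind fun C => ?_)
  exact sdiff_le_iff.trans (avoidCones_le_join_iff hh)

theorem deg_avoidCones_sup (h : ℕ → ℕ → ℕ) (S T : Set ℕ) :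
    MedvedevDegree.deg (avoidCones h S) ⊔ MedvedevDegree.deg (avoidCones h T) =
      MedvedevDegree.deg (avoidCones h (S ∪ T)) := by
  refine le_antisymm (sup_le (avoidCones_mono h Set.subset_union_left)
    (avoidCones_mono h Set.subset_union_right)) ?_
  refine (isUpwardClosed_avoidCones h _).le_iff.2 ?_
  rintro _ ⟨f, hf, g, hg, rfl⟩ i (hi | hi) hred
  · exact hf i hi ((turingReducible_turingJoin_left f g).trans hred)
  · exact hg i hi ((turingReducible_turingJoin_right f g).trans hred)

/-- If `i ∈ S` were not in `T`, then `h i` itself would solve the second problem but not the first.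
-/
theorem subset_of_avoidCones_le (hh : ∀ i j, i ≠ j →
      ¬ TuringReducible (h i : ℕ →. ℕ) (h j : ℕ →. ℕ)) {S T : Set ℕ}
    (hST : avoidCones h S ≤ avoidCones h T) : S ⊆ T := by
  intro i hi
  by_contra hiT
  refine (isUpwardClosed_avoidCones h _).le_iff.1 hST (fun j hj => hh i j ?_) i hi (.refl _)
  rintro rfl
  exact hiT hj

end AvoidCones

/-! ### Calculation in factors -/

namespace Factor

variable {L : Type*} [CoheytingAlgebra L] {b : L}

theorem mk_sup (x y : L) : mk b x ⊔ mk b y = mk b (x ⊔ y) := rfl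

theorem mk_inf (x y : L) : mk b x ⊓ mk b y = mk b (x ⊓ y) := rfl

theorem mk_sdiff (x y : L) : mk b x \ mk b y = mk b ((x ⊓ b) \ y) := rfl

theorem mk_self : mk b b = ⊤ := top_unique (mk_le_mk.2 inf_le_right)

theorem mk_le_mk_of_le {x y : L} (h : x ≤ y) : mk b x ≤ mk b y :=
  mk_le_mk.2 (inf_le_left.trans h)

/-- Implication in the factor only cuts the conclusion down to its meet with `b`, and this commutes
with meets. -/
theorem inf_sdiff_mk_le {d : L} (hd : ∀ x y, x \ d ⊓ y \ d ≤ (x ⊓ y) \ d) (x y : Factor b) :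
    x \ mk b d ⊓ y \ mk b d ≤ (x ⊓ y) \ mk b d := by
  induction x using ind with
  | h x =>
  induction y using ind with
  | h y =>
  simp only [mk_sdiff, mk_inf]
  refine mk_le_mk_of_le ((hd _ _).trans ?_)
  rw [← inf_inf_distrib_right]

end Factor

/-! ### The embeddings into the factor and the Kreisel–Putnam logic -/

theorem bEmbeddable_factor_avoidCones {h : ℕ → ℕ → ℕ}
    (hh : ∀ i j, i ≠ j → ¬ TuringReducible (h i : ℕ →. ℕ) (h j : ℕ →. ℕ)) {n : ℕ} (hn : 1 ≤ n) :
    BEmbeddable (MedvedevAlgebra n)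
      (Factor (MedvedevDegree.deg (avoidCones h Set.univ))) := by
  have : NeZero n := ⟨by omega⟩
  set B := MedvedevDegree.deg (avoidCones h Set.univ) with hB
  -- Residues modulo `n` split all of `ℕ` into `n` nonempty classes, so one `B` serves every `n`.
  -- Taking the complement of `s` turns intersections into unions and sends `∅` to `B`.
  let P : Finset (Fin n) → Set ℕ := fun s => {i | Fin.ofNat n i ∉ s}
  let A : Finset (Fin n) → MedvedevDegree := fun s => MedvedevDegree.deg (avoidCones h (P s))
  have hAB : ∀ s, A s ⊓ B = A s := fun s =>
    inf_eq_left.2 (avoidCones_mono h (Set.subset_univ _))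
  refine MedvedevAlgebra.bEmbeddable_of_simplices (fun s => Factor.mk B (A s)) ?_ ?_ ?_ ?_ ?_ ?_
  · have : P ∅ = Set.univ := by ext; simp [P]
    simp only [A, this]
    exact Factor.mk_self
  · intro s t
    have : P (s ∩ t) = P s ∪ P t := by ext; simp [P, imp_iff_not_or]
    simp only [Factor.mk_sup, A, deg_avoidCones_sup, this]
  · intro s t
    have : P (t ∪ sᶜ) = P t \ P s := by ext; simp [P]
    simp only [Factor.mk_sdiff, hAB]
    simp only [A, deg_avoidCones_sdiff hh, this, le_refl]
  · exact fun s => Factor.inf_sdiff_mk_le (isMuchnik_avoidCones h _).inf_sdiff_le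
  · intro s t hst
    have h1 := Factor.mk_le_mk.1 hst
    rw [hAB] at h1
    have h2 := subset_of_avoidCones_le hh h1
    intro i hi
    by_contra his
    have h3 : (i : ℕ) ∈ P s := by simpa [P] using his
    exact h2 h3 (by simpa using hi)
  · intro s x y hxy
    induction x using Factor.ind with
    | h x =>
    induction y using Factor.ind with
    | h y =>
    simp only [Factor.mk_inf, Factor.mk_le_mk] at hxy ⊢
    rw [inf_inf_distrib_right] at hxy
    exact (isMuchnik_avoidCones h _).le_or_le_of_inf_le hxy

theorem logicKP_subset_brouwerTheory {B : MedvedevDegree} (hB : B.IsMuchnik) :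
    LogicKP ⊆ BrouwerTheory (Factor B) := by
  intro φ hφ
  refine PropForm.Derivable.eval_eq_bot (Set.singleton_subset_iff.2 ?_) hφ
  refine PropForm.kreiselPutnam_mem_brouwerTheory fun p => ?_
  induction p using Factor.ind with
  | h p =>
  -- `B` represents the top of the factor, so each negation is the class of a Muchnik degree
  -- although `p` is arbitrary.
  have e : (⊤ : Factor B) \ Factor.mk B p = Factor.mk B (B \ p) := by
    rw [← Factor.mk_self, Factor.mk_sdiff, inf_idem]
  rw [e]
  exact Factor.inf_sdiff_mk_le (hB.sdiff p).inf_sdiff_le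

theorem corollary5 :
    (∃ B : MedvedevDegree, B.IsMuchnik ∧
      ∀ n : ℕ, 1 ≤ n → BEmbeddable (MedvedevAlgebra n) (Factor B)) ∧
    (∀ B : MedvedevDegree, B.IsMuchnik →
      (∀ n : ℕ, 1 ≤ n → BEmbeddable (MedvedevAlgebra n) (Factor B)) →
      LogicKP ⊆ BrouwerTheory (Factor B) ∧ BrouwerTheory (Factor B) ⊆ LogicLM) := by
  refine ⟨?_, fun B hB h => ⟨logicKP_subset_brouwerTheory hB,
    fun φ hφ n hn => (h n hn).brouwerTheory_subset hφ⟩⟩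
  obtain ⟨h, hh⟩ := exists_turing_antichain
  exact ⟨_, isMuchnik_avoidCones h Set.univ, fun n hn => bEmbeddable_factor_avoidCones hh hn⟩
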